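/- Let $V\in L^\infty(\mathbb R^2)$ be a real-valued bounded function with $V>0$ almost everywhere, and let $H=-\Delta-V$ be the Schrödinger operator in $L^2(\mathbb R^2)$ with domain $H^2(\mathbb R^2)$. Let $N\ge 0$ be an integer, and assume that the negative spectrum of $H$ consists of $N$ eigenvalues counted with multiplicity, that is, $\sigma(H)\cap(-\infty,0)$ is a finite set of eigenvalues of finite multiplicity whose multiplicities add up to $N$. Then $V\in L^1(\mathbb R^2)$ and $$\int_{\mathbb R^2} V\,dx\le (6^4+12+4N)\,N .$$ -/

import Mathlib

open MeasureTheory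
open scoped ENNReal Laplacian SchwartzMap

noncomputable section

namespace Schrodinger

/-- The Euclidean plane. -/
abbrev Plane := EuclideanSpace ℝ (Fin 2)

/-- The complex Hilbert space `L²(ℝ²)` with respect to Lebesgue measure. -/
abbrev L2 := Lp ℂ 2 (volume : Measure Plane)

/-- An `L²` function is determined by the tempered distribution it defines. -/
theorem toTemperedDistribution_injective {f g : L2} (h : (f : 𝓢'(Plane, ℂ)) = g) : f = g := by
  have hker := Lp.ker_toTemperedDistributionCLM_eq_bot (F := ℂ) (μ := (volume : Measure Plane))
    (p := 2)
  exact LinearMap.ker_eq_bot.mp hker h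

/-- The Sobolev space `H²(ℝ²)`, as a subspace of `L²(ℝ²)`. -/
def sobolevH2 : Submodule ℂ L2 where
  carrier := {u | TemperedDistribution.MemSobolev 2 2 (u : 𝓢'(Plane, ℂ))}
  add_mem' {u v} hu hv := by
    have := TemperedDistribution.MemSobolev.add hu hv
    simpa only [Set.mem_ofPred_eq, ← Lp.toTemperedDistributionCLM_apply, map_add] using this
  zero_mem' := by
    simpa only [Set.mem_ofPred_eq, ← Lp.toTemperedDistributionCLM_apply, map_zero] using
      TemperedDistribution.memSobolev_fun_zero Plane ℂ 2 2
  smul_mem' c u hu := by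
    have := TemperedDistribution.MemSobolev.smul c hu
    simpa only [Set.mem_ofPred_eq, ← Lp.toTemperedDistributionCLM_apply, map_smul] using this

/-- The distributional Laplacian of an `L²` function, a tempered distribution. -/
def distribLaplacian : L2 →ₗ[ℂ] 𝓢'(Plane, ℂ) :=
  (LineDeriv.laplacianCLM ℂ Plane 𝓢'(Plane, ℂ)).toLinearMap ∘ₗ
    (Lp.toTemperedDistributionCLM ℂ (volume : Measure Plane) 2).toLinearMap

theorem distribLaplacian_apply (u : L2) : distribLaplacian u = Δ (u : 𝓢'(Plane, ℂ)) :=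
  TemperedDistribution.laplacianCLM_apply _

/-- The distributional Laplacian of an `H²` function is an `L²` function. -/
theorem exists_laplacian (u : sobolevH2) :
    ∃ f : L2, distribLaplacian u = (f : 𝓢'(Plane, ℂ)) := by
  have h := TemperedDistribution.MemSobolev.laplacian u.2
  rw [sub_self] at h
  rw [distribLaplacian_apply]
  exact TemperedDistribution.memSobolev_zero_iff.mp h

/-- The Laplacian `Δ : H²(ℝ²) → L²(ℝ²)`, taken in the sense of distributions. -/
def laplacianL2 : sobolevH2 →ₗ[ℂ] L2 where
  toFun u := (exists_laplacian u).choose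
  map_add' u v := by
    apply toTemperedDistribution_injective
    have hu := (exists_laplacian u).choose_spec
    have hv := (exists_laplacian v).choose_spec
    have huv := (exists_laplacian (u + v)).choose_spec
    refine (huv.symm.trans (map_add distribLaplacian (u : L2) (v : L2))).trans ?_
    refine (congrArg₂ (· + ·) hu hv).trans ?_
    exact (map_add (Lp.toTemperedDistributionCLM ℂ (volume : Measure Plane) 2) _ _).symm
  map_smul' c u := by
    apply toTemperedDistribution_injective
    have hu := (exists_laplacian u).choose_spec
    have hcu := (exists_laplacian (c • u)).choose_spec
    refine (hcu.symm.trans (map_smul distribLaplacian c (u : L2))).trans ?_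
    refine (congrArg (c • ·) hu).trans ?_
    exact (map_smul (Lp.toTemperedDistributionCLM ℂ (volume : Measure Plane) 2) _ _).symm

/-- The defining property of the Laplacian: it is the distributional one. -/
theorem laplacianL2_spec (u : sobolevH2) :
    (laplacianL2 u : 𝓢'(Plane, ℂ)) = Δ ((u : L2) : 𝓢'(Plane, ℂ)) := by
  rw [← distribLaplacian_apply]
  exact (exists_laplacian u).choose_spec.symm

/-- A bounded real function, as an element of the complex space `L^∞(ℝ²)`. -/
def toLinfty (V : Plane → ℝ) (hV : MemLp V ∞ volume) : Lp ℂ ∞ (volume : Measure Plane) :=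
  MemLp.toLp (fun x => (V x : ℂ)) hV.ofReal

/-- The operator of multiplication by a bounded real function `V` on `L²(ℝ²)`. -/
def mulPotential (V : Plane → ℝ) (hV : MemLp V ∞ volume) : L2 →ₗ[ℂ] L2 where
  toFun u := toLinfty V hV • u
  map_add' u v := Lp.add_smul (toLinfty V hV) u v
  map_smul' c u := (Lp.smul_comm c (toLinfty V hV) u).symm

/-- The multiplication operator acts pointwise almost everywhere. -/
theorem mulPotential_ae (V : Plane → ℝ) (hV : MemLp V ∞ volume) (u : L2) :
    ∀ᵐ x : Plane, (mulPotential V hV u) x = (V x : ℂ) * u x := by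
  have h : ∀ᵐ x : Plane, (mulPotential V hV u) x = (toLinfty V hV) x • u x :=
    Lp.coeFn_lpSMul (r := 2) (toLinfty V hV) u
  have h' : ∀ᵐ x : Plane, (toLinfty V hV) x = (V x : ℂ) :=
    MemLp.coeFn_toLp (f := fun x => (V x : ℂ)) hV.ofReal
  filter_upwards [h, h'] with x hx hx'
  rw [hx, hx', smul_eq_mul]

/-- The Schrödinger operator `H = -Δ - V` in `L²(ℝ²)`, an unbounded operator whose domain
is `H²(ℝ²)`. -/
def schrodingerOp (V : Plane → ℝ) (hV : MemLp V ∞ volume) : L2 →ₗ.[ℂ] L2 where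
  domain := sobolevH2
  toFun := -laplacianL2 - mulPotential V hV ∘ₗ sobolevH2.subtype

section Spectrum

variable {E : Type*} [NormedAddCommGroup E] [NormedSpace ℂ E]

/-- The resolvent set of an unbounded operator `T`: the complex numbers `z` such that `T - z`,
from the domain of `T` onto the whole space, has a bounded everywhere defined inverse. -/
def resolventSet (T : E →ₗ.[ℂ] E) : Set ℂ :=
  {z | ∃ R : E →L[ℂ] E,
    (∀ f : E, ∃ h : R f ∈ T.domain, T ⟨R f, h⟩ - z • R f = f) ∧
    ∀ u : T.domain, R (T u - z • (u : E)) = u}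

/-- The spectrum of an unbounded operator. -/
def spectrum (T : E →ₗ.[ℂ] E) : Set ℂ := (resolventSet T)ᶜ

/-- The space of all `u` in the domain of `T` with `T u = z u`. -/
def eigenspace (T : E →ₗ.[ℂ] E) (z : ℂ) : Submodule ℂ T.domain :=
  LinearMap.ker (T.toFun - z • T.domain.subtype)

/-- The negative spectrum of `T` consists of `N` eigenvalues, counted with multiplicity: the part
of the spectrum on the negative half-line is a finite set `s`, each point of `s` is an eigenvalue
of finite multiplicity, and these multiplicities add up to `N`. -/
def NegativeSpectrumConsistsOf (T : E →ₗ.[ℂ] E) (N : ℕ) : Prop :=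
  ∃ s : Finset ℝ,
    (∀ t : ℝ, t ∈ s ↔ t < 0 ∧ (t : ℂ) ∈ spectrum T) ∧
    (∀ t ∈ s, eigenspace T (t : ℂ) ≠ ⊥ ∧ FiniteDimensional ℂ (eigenspace T (t : ℂ))) ∧
    ∑ t ∈ s, Module.finrank ℂ (eigenspace T (t : ℂ)) = N

end Spectrum

end Schrodinger

end

/-!
A Schrödinger operator whose negative spectrum consists of `N` eigenvalues cannot be negative
definite on a space of dimension `N + 1` (`exists_ne_zero_form_nonneg`). This is proved for every
symmetric operator `T`: if `-c` lies below the negative spectrum, the bounded inverse `R` of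
`T + c` is self-adjoint with spectrum in `[0, 1 / c]` up to finitely many eigenvalues, and the
continuous functional calculus gives the spectral projections. Consequently there are no `N + 1`
test functions with disjoint supports and Dirichlet energy below their potential energy
(`false_of_disjoint_negative_energy`).

If the mass of `V` is large, such test functions are constructed as follows. Squares are selected
one after the other, each of mass at least `84` outside the `1.9`-fold dilations of the previous
ones. A square of almost minimal size with this property has a dilation of mass at most `4 * 84`,
being covered by four smaller squares, so that `2 * N + 1` squares can be selected if the mass of
`V` exceeds `(2 * N + 1) * 4 * 84` (`exists_squares`). The test function of a square is the
minimum of an outer cutoff and of cutoffs that create holes around all previous squares. Its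
energy is not bounded individually, since the number of holes is not. However, the supports are
disjoint, so the cutoff of the hole around a given square is seen at each point by at most one
later test function. Hence the hole energies add up to at most a constant times the number of
squares (`sum_holeEnergy_le`), and at least `N + 1` test functions have an energy below `84`
(`potentialMeasure_univ_le`).

This gives the bound `(2 * N + 1) * 336`, which suffices if `N ≥ 1`. The case `N = 0` does not
occur: averages of cutoffs on many dyadic annuli have arbitrarily small Dirichlet energy, so in
the plane every potential `V > 0` has a bound state (`not_negativeSpectrumConsistsOf_zero`).
-/

namespace Schrodinger

/-! ### Symmetric operators with finite negative spectrum -/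

section Spectral

variable {E : Type*} [NormedAddCommGroup E] [InnerProductSpace ℂ E]

/-- If a set is contained in `F ∪ (-∞, b]`, where `F` is finite and lies above `b`, then its points
in `F` are isolated and their indicator functions are continuous on it. -/
theorem continuousOn_ite_eq_of_subset {σ : Set ℝ} {F : Finset ℝ} {b : ℝ}
    (hσ : σ ⊆ ↑F ∪ Set.Iic b) (hF : ∀ t ∈ F, b < t) (m : ℝ) (hm : m ∈ F) :
    ContinuousOn (fun t => if t = m then (1 : ℝ) else 0) σ := by
  intro t ht
  by_cases htm : t = m
  · subst htm
    have hopen : IsOpen ((↑(F.erase t) ∪ Set.Iic b : Set ℝ)ᶜ) :=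
      ((F.erase t).finite_toSet.isClosed.union isClosed_Iic).isOpen_compl
    have hmem : t ∈ ((↑(F.erase t) ∪ Set.Iic b : Set ℝ)ᶜ) := by
      simp [hF t hm]
    refine (continuousWithinAt_const (b := (1 : ℝ))).congr_of_eventuallyEq ?_ (by simp)
    filter_upwards [mem_nhdsWithin_of_mem_nhds (hopen.mem_nhds hmem), self_mem_nhdsWithin]
      with y hy hyσ
    have := hσ hyσ
    simp only [Finset.coe_erase, Set.mem_compl_iff, Set.mem_union, Set.mem_sdiff, Finset.mem_coe,
      Set.mem_singleton_iff, Set.mem_Iic, not_or, not_and, not_not] at hy this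
    rcases this with h | h
    · simp [hy.1 h]
    · exact absurd h hy.2
  · refine (continuousWithinAt_const (b := (0 : ℝ))).congr_of_eventuallyEq ?_ (by simp [htm])
    filter_upwards [mem_nhdsWithin_of_mem_nhds (isOpen_compl_singleton.mem_nhds htm)] with y hy
    have : y ≠ m := hy
    simp [this]

/-- If `R` is the bounded inverse of `T + c`, then `m ↦ 1 / m - c` maps the nonzero real spectrum of
`R` into the spectrum of `T`. -/
theorem spectrum_shiftedInverse_subset (T : E →ₗ.[ℂ] E) (R : E →L[ℂ] E) (c : ℝ)
    (hR1 : ∀ f : E, ∃ h : R f ∈ T.domain, T ⟨R f, h⟩ + (c : ℂ) • R f = f)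
    (hR2 : ∀ u : T.domain, R (T u + (c : ℂ) • (u : E)) = u)
    {m : ℝ} (hm0 : m ≠ 0) (hm : m ∈ _root_.spectrum ℝ R) :
    ((m⁻¹ - c : ℝ) : ℂ) ∈ Schrodinger.spectrum T := by
  rintro ⟨S, hS1, hS2⟩
  apply hm
  have hmC : (m : ℂ) ≠ 0 := by exact_mod_cast hm0
  have hY : ∀ f, f + (m⁻¹ : ℂ) • S f = T ⟨S f, (hS1 f).1⟩ + (c : ℂ) • S f := by
    intro f
    have h := (hS1 f).2
    nth_rw 1 [← h]
    push_cast
    module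
  have hZ : ∀ f, (m : ℂ) • f - R f =
      (m : ℂ) • (T ⟨R f, (hR1 f).1⟩ - ((m⁻¹ - c : ℝ) : ℂ) • R f) := by
    intro f
    have h := (hR1 f).2
    nth_rw 1 [← h]
    push_cast
    rw [smul_sub, smul_smul, mul_sub, mul_inv_cancel₀ hmC]
    module
  have hSZ : ∀ f, S ((m : ℂ) • f - R f) = (m : ℂ) • R f := by
    intro f
    rw [hZ, map_smul, hS2 ⟨R f, (hR1 f).1⟩]
  have hRY : ∀ f, R (f + (m⁻¹ : ℂ) • S f) = S f := by
    intro f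
    rw [hY, hR2 ⟨S f, (hS1 f).1⟩]
  set A : E →L[ℂ] E := algebraMap ℝ (E →L[ℂ] E) m - R with hA
  have hAf : ∀ f, A f = (m : ℂ) • f - R f := by
    intro f
    rw [hA, _root_.sub_apply, Algebra.algebraMap_eq_smul_one]
    simp
  set B : E →L[ℂ] E := (m⁻¹ : ℂ) • (ContinuousLinearMap.id ℂ E + (m⁻¹ : ℂ) • S) with hB
  have hBf : ∀ f, B f = (m⁻¹ : ℂ) • (f + (m⁻¹ : ℂ) • S f) := by
    intro f; simp [hB]
  refine isUnit_iff_exists.2 ⟨B, ?_, ?_⟩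
  · ext f
    change A (B f) = f
    rw [hAf, hBf, map_smul, hRY, smul_smul, mul_inv_cancel₀ hmC, one_smul]
    module
  · ext f
    change B (A f) = f
    rw [hBf, hAf, hSZ, smul_smul, inv_mul_cancel₀ hmC, one_smul, sub_add_cancel, smul_smul,
      inv_mul_cancel₀ hmC, one_smul]

/-- A symmetric operator whose negative spectrum consists of `N` eigenvalues has no negative
definite subspace of dimension `N + 1`: the quadratic form takes a nonnegative value at the image of
some nonzero vector under any linear map from `ℂ ^ (N + 1)`. -/
theorem exists_ne_zero_form_nonneg [CompleteSpace E] (T : E →ₗ.[ℂ] E)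
    (hsym : ∀ u v : T.domain, inner ℂ (T u) (v : E) = inner ℂ (u : E) (T v)) {N : ℕ}
    (hN : NegativeSpectrumConsistsOf T N) (Φ : (Fin (N + 1) → ℂ) →ₗ[ℂ] T.domain) :
    ∃ a, a ≠ 0 ∧ 0 ≤ (inner ℂ (T (Φ a)) (Φ a : E)).re := by
  obtain ⟨s, hs, hfin, hsum⟩ := hN
  -- `-c` lies below the negative spectrum, so that `T + c` has a bounded inverse `R`
  obtain ⟨c, hc0, hcs⟩ : ∃ c : ℝ, 0 < c ∧ ∀ t ∈ s, -c < t := by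
    refine ⟨1 + ∑ t ∈ s, |t|, by positivity, fun t ht => ?_⟩
    have h1 : |t| ≤ ∑ t ∈ s, |t| := Finset.single_le_sum (f := fun t => |t|)
      (fun i _ => abs_nonneg i) ht
    have := neg_abs_le t
    linarith
  have hcres : ((-c : ℝ) : ℂ) ∈ resolventSet T := by
    by_contra h
    have := (hs (-c)).2 ⟨by linarith, h⟩
    exact lt_irrefl _ (hcs _ this)
  obtain ⟨R, hR1', hR2'⟩ := hcres
  have hR1 : ∀ f : E, ∃ h : R f ∈ T.domain, T ⟨R f, h⟩ + (c : ℂ) • R f = f := by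
    intro f
    obtain ⟨h, h'⟩ := hR1' f
    refine ⟨h, ?_⟩
    rw [← sub_neg_eq_add, ← neg_smul]
    simpa using h'
  have hR2 : ∀ u : T.domain, R (T u + (c : ℂ) • (u : E)) = u := by
    intro u
    rw [← sub_neg_eq_add, ← neg_smul]
    simpa using hR2' u
  have hspec : ∀ m : ℝ, m ≠ 0 → m ∈ _root_.spectrum ℝ R →
      ((m⁻¹ - c : ℝ) : ℂ) ∈ Schrodinger.spectrum T :=
    fun m => spectrum_shiftedInverse_subset T R c hR1 hR2
  have hinj : ∀ g, R g = 0 → g = 0 := by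
    intro g hg
    obtain ⟨h, h'⟩ := hR1 g
    have h0 : (⟨R g, h⟩ : T.domain) = 0 := by ext; exact hg
    rw [h0, hg] at h'
    simpa using h'.symm
  have hsa : IsSelfAdjoint R := by
    rw [ContinuousLinearMap.isSelfAdjoint_iff_isSymmetric]
    intro f g
    obtain ⟨hf, hf'⟩ := hR1 f
    obtain ⟨hg, hg'⟩ := hR1 g
    change inner ℂ (R f) g = inner ℂ f (R g)
    have := hsym ⟨R f, hf⟩ ⟨R g, hg⟩
    nth_rw 1 [← hg']
    nth_rw 2 [← hf']
    rw [inner_add_left, inner_add_right, inner_smul_left, inner_smul_right, ← this]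
    simp
  -- the spectrum of `R` lies in `[0, 1/c]`, apart from the finite set `F`
  set F : Finset ℝ := s.image (fun t => (t + c)⁻¹) with hFdef
  have hFb : ∀ m ∈ F, c⁻¹ < m := by
    intro m hm
    obtain ⟨t, ht, rfl⟩ := Finset.mem_image.1 hm
    have h1 := hcs t ht
    have h2 := ((hs t).1 ht).1
    exact inv_strictAnti₀ (by linarith) (by linarith)
  have hσpos : ∀ m ∈ _root_.spectrum ℝ R, 0 ≤ m := by
    intro m hm
    by_contra! h
    have h1 := hspec m h.ne hm
    have h2 : m⁻¹ < 0 := inv_lt_zero.2 h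
    have := hcs _ ((hs _).2 ⟨by linarith, h1⟩)
    linarith
  have hσ : _root_.spectrum ℝ R ⊆ ↑F ∪ Set.Iic c⁻¹ := by
    intro m hm
    by_cases h : m ≤ c⁻¹
    · exact Or.inr h
    · left
      push Not at h
      have hm0 : 0 < m := lt_trans (by positivity) h
      have h1 := hspec m hm0.ne' hm
      have h2 : m⁻¹ < c := by
        rw [inv_lt_comm₀ hm0 hc0]; exact h
      have h3 := (hs _).2 ⟨by linarith, h1⟩
      rw [Finset.mem_coe, hFdef, Finset.mem_image]
      exact ⟨_, h3, by simp⟩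
  -- `P m` is the spectral projection of `R` at `m ∈ F`; its range consists of eigenvectors of `T`
  let χ : ℝ → ℝ → ℝ := fun m t => if t = m then 1 else 0
  have hχc : ∀ m ∈ F, ContinuousOn (χ m) (_root_.spectrum ℝ R) := fun m hm =>
    continuousOn_ite_eq_of_subset hσ hFb m hm
  let P : ℝ → E →L[ℂ] E := fun m => cfc (χ m) R
  have hidP : ∀ m ∈ F, cfc (fun t => t * χ m t) R = R * P m := fun m hm => by
    rw [cfc_mul (fun t => t) (χ m) R (by fun_prop) (hχc m hm), cfc_id' ℝ R]
  have hRP : ∀ m ∈ F, R * P m = m • P m := by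
    intro m hm
    rw [← hidP m hm, ← cfc_const_mul m (χ m) R (hχc m hm)]
    congr 1
    ext t
    by_cases h : t = m <;> simp [χ, h]
  have hPR : ∀ m ∈ F, P m * R = R * P m := by
    intro m hm
    have h2 : cfc (fun t => χ m t * t) R = P m * R := by
      rw [cfc_mul (χ m) (fun t => t) R (hχc m hm) (by fun_prop), cfc_id' ℝ R]
    rw [← hidP m hm, ← h2]
    simp_rw [mul_comm]
  have heig : ∀ t ∈ s, ∀ g, ∃ h : P ((t + c)⁻¹) g ∈ T.domain,
      (⟨_, h⟩ : T.domain) ∈ eigenspace T (t : ℂ) := by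
    intro t ht g
    have htc : 0 < t + c := by have := hcs t ht; linarith
    have hmF : (t + c)⁻¹ ∈ F := Finset.mem_image_of_mem _ ht
    have h1 : R (P ((t + c)⁻¹) g) = ((t + c)⁻¹ : ℝ) • P ((t + c)⁻¹) g := by
      have := congrArg (fun A : E →L[ℂ] E => A g) (hRP _ hmF)
      exact this
    have h2 : P ((t + c)⁻¹) g = R (((t + c : ℝ) : ℂ) • P ((t + c)⁻¹) g) := by
      rw [map_smul, h1, Complex.coe_smul, smul_smul, mul_inv_cancel₀ htc.ne', one_smul]
    obtain ⟨h, h'⟩ := hR1 (((t + c : ℝ) : ℂ) • P ((t + c)⁻¹) g)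
    have hd : P ((t + c)⁻¹) g ∈ T.domain := by rw [h2]; exact h
    refine ⟨hd, ?_⟩
    have h3 : (⟨_, h⟩ : T.domain) = ⟨_, hd⟩ := by ext; exact h2.symm
    rw [h3, ← h2] at h'
    rw [eigenspace, LinearMap.mem_ker]
    change T ⟨_, hd⟩ - (t : ℂ) • P ((t + c)⁻¹) g = 0
    rw [eq_sub_of_add_eq h']
    push_cast
    module
  -- the eigenspaces have total dimension `N`, so some `Φ a` is annihilated by all projections
  let Ψ : (Fin (N + 1) → ℂ) →ₗ[ℂ] ((t : s) → eigenspace T ((t : ℝ) : ℂ)) :=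
    LinearMap.pi fun t =>
      { toFun := fun a => ⟨⟨_, (heig t t.2 (Φ a : E)).1⟩, (heig t t.2 (Φ a : E)).2⟩
        map_add' := by intro a b; ext; simp
        map_smul' := by intro a b; ext; simp }
  have : ∀ t : s, FiniteDimensional ℂ (eigenspace T ((t : ℝ) : ℂ)) := fun t => (hfin t t.2).2
  have hdim : Module.finrank ℂ ((t : s) → eigenspace T ((t : ℝ) : ℂ)) <
      Module.finrank ℂ (Fin (N + 1) → ℂ) := by
    rw [Module.finrank_pi_fintype, Module.finrank_fin_fun]
    rw [Finset.sum_coe_sort s (fun t : ℝ => Module.finrank ℂ (eigenspace T (t : ℂ))), hsum]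
    omega
  obtain ⟨a, hak, ha0⟩ :=
    (Submodule.ne_bot_iff _).1 (LinearMap.ker_ne_bot_of_finrank_lt hdim (f := Ψ))
  refine ⟨a, ha0, ?_⟩
  set u := Φ a with hu
  have hPu : ∀ m ∈ F, P m (u : E) = 0 := by
    intro m hm
    obtain ⟨t, ht, rfl⟩ := Finset.mem_image.1 hm
    have h1 := congrFun (LinearMap.mem_ker.1 hak) ⟨t, ht⟩
    have h2 := congrArg (fun z : eigenspace T ((t : ℝ) : ℂ) => ((z : T.domain) : E)) h1
    exact h2
  set f : E := T u + (c : ℂ) • (u : E) with hf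
  have hRf : R f = u := hR2 u
  have hPf : ∀ m ∈ F, P m f = 0 := by
    intro m hm
    apply hinj
    have h1 := congrArg (fun A : E →L[ℂ] E => A f) (hPR m hm)
    change P m (R f) = R (P m f) at h1
    rw [← h1, hRf, hPu m hm]
  -- with `f = (T + c) u` the form is `⟪f, q(R) f⟫`, and `q ≥ 0` on the spectrum of `R` off `F`
  let q : ℝ → ℝ := fun t => t - c * (t * t)
  let ψ : ℝ → ℝ := fun t => ∑ m ∈ F, χ m t
  have hψc : ContinuousOn ψ (_root_.spectrum ℝ R) :=
    continuousOn_finsetSum F fun m hm => hχc m hm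
  have hqc : Continuous q := by fun_prop
  have hψ : cfc ψ R = ∑ m ∈ F, P m := by
    have := cfc_sum χ R F (fun m hm => hχc m hm)
    rw [← this]
    congr 1
    ext t
    simp [ψ]
  have hψval : ∀ t, ψ t = if t ∈ F then 1 else 0 := by
    intro t
    simp [ψ, χ]
  have hqR : cfc q R = R - (c : ℂ) • (R * R) := by
    have h1 : cfc (fun t : ℝ => t * t) R = R * R := by
      rw [cfc_mul (fun t => t) (fun t => t) R (by fun_prop) (by fun_prop), cfc_id' ℝ R]
    rw [cfc_sub (fun t => t) (fun t => c * (t * t)) R (by fun_prop) (by fun_prop), cfc_id' ℝ R,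
      cfc_const_mul c (fun t => t * t) R (by fun_prop), h1]
    rfl
  have hsplit : cfc q R = cfc (fun t => q t * (1 - ψ t)) R + cfc q R * ∑ m ∈ F, P m := by
    rw [← hψ, ← cfc_mul q ψ R (by fun_prop) hψc,
      ← cfc_add (a := R) (fun t => q t * (1 - ψ t)) (fun t => q t * ψ t)
        (hqc.continuousOn.mul (continuousOn_const.sub hψc)) (hqc.continuousOn.mul hψc)]
    congr 1
    ext t
    ring
  have hpos : 0 ≤ cfc (fun t => q t * (1 - ψ t)) R := by
    apply cfc_nonneg
    intro t ht
    rw [hψval]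
    by_cases h : t ∈ F
    · simp [h]
    · have h0 := hσpos t ht
      have h1 : t ≤ c⁻¹ := by
        rcases hσ ht with h' | h'
        · exact absurd h' h
        · exact h'
      have h2 : c * t ≤ 1 := by
        calc c * t ≤ c * c⁻¹ := by gcongr
          _ = 1 := mul_inv_cancel₀ hc0.ne'
      simp only [h, if_false, sub_zero, mul_one, q]
      nlinarith
  have hpos' := (ContinuousLinearMap.nonneg_iff_isPositive _).1 hpos
  have hval : cfc q R f = cfc (fun t => q t * (1 - ψ t)) R f := by
    nth_rw 1 [hsplit]
    have : (∑ m ∈ F, P m) f = 0 := by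
      rw [_root_.sum_apply]
      exact Finset.sum_eq_zero hPf
    rw [_root_.add_apply, mul_apply_eq_comp, this, map_zero, add_zero]
  have hTu : T u = f - (c : ℂ) • R f := by rw [hRf, hf]; simp
  have hfin : inner ℂ (T u) (u : E) = inner ℂ (cfc q R f) f := by
    rw [hTu, ← hRf, hqR]
    have hs' := (ContinuousLinearMap.isSelfAdjoint_iff_isSymmetric.1 hsa)
    have e1 : inner ℂ f (R f) = inner ℂ (R f) f := (hs' f f).symm
    have e2 : inner ℂ (R f) (R f) = inner ℂ (R (R f)) f := (hs' (R f) f).symm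
    simp only [_root_.sub_apply, _root_.smul_apply,
      mul_apply_eq_comp, inner_sub_left, inner_smul_left, e1, e2]
  rw [hfin, hval]
  exact hpos'.re_inner_nonneg_left f

end Spectral

/-! ### Symmetry of the Schrödinger operator -/

section Symmetry

open TemperedDistribution FourierTransform

theorem memLp_top_symbol :
    MemLp (fun x : Plane => (((1 + ‖x‖ ^ 2) ^ (-1 : ℝ) : ℝ) : ℂ)) ∞ volume := by
  have hc : Continuous (fun x : Plane => (((1 + ‖x‖ ^ 2) ^ (-1 : ℝ) : ℝ) : ℂ)) := by
    refine Complex.continuous_ofReal.comp (Continuous.rpow_const (by fun_prop) ?_)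
    intro x; left; positivity
  refine memLp_top_of_bound hc.aestronglyMeasurable 1 (Filter.Eventually.of_forall fun x => ?_)
  rw [Complex.norm_real, Real.norm_of_nonneg (by positivity)]
  exact Real.rpow_le_one_of_one_le_of_nonpos (by simp) (by norm_num)

/-- The Fourier multiplier form of `H²`: with `f = (1 - (2π)⁻² Δ) u` in `L²`, the Fourier transform
of `u` is that of `f` times the bounded real function `(1 + ‖x‖²)⁻¹`. -/
theorem exists_fourier_representation (u : sobolevH2) :
    ∃ f : L2, laplacianL2 u = (((2 * Real.pi) ^ 2 : ℝ) : ℂ) • ((u : L2) - f) ∧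
      𝓕 (u : L2) = memLp_top_symbol.toLp _ • 𝓕 f := by
  obtain ⟨f, hf⟩ := u.2
  refine ⟨f, ?_, ?_⟩
  · apply toTemperedDistribution_injective
    rw [laplacianL2_spec]
    change _ = Lp.toTemperedDistributionCLM ℂ (volume : Measure Plane) 2 _
    rw [map_smul, map_sub,
      Lp.toTemperedDistributionCLM_apply, Lp.toTemperedDistributionCLM_apply, ← hf,
      laplacian_eq_fourierMultiplierCLM]
    have h : besselPotential Plane ℂ 2 ((u : L2) : 𝓢'(Plane, ℂ)) = ((u : L2) : 𝓢'(Plane, ℂ)) +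
        fourierMultiplierCLM ℂ (fun x => Complex.ofReal (‖x‖ ^ 2)) ((u : L2) : 𝓢'(Plane, ℂ)) := by
      rw [besselPotential]
      have h1 : (fun x : Plane => (((1 + ‖x‖ ^ 2) ^ ((2 : ℝ) / 2) : ℝ) : ℂ)) =
          fun x => ∑ i : Fin 2,
            (![fun _ => (1 : ℂ), fun x : Plane => Complex.ofReal (‖x‖ ^ 2)] i) x := by
        ext x
        simp
      rw [h1, fourierMultiplierCLM_sum]
      · simp
      · intro i _
        fin_cases i
        · exact Function.HasTemperateGrowth.const 1
        · change Function.HasTemperateGrowth (fun x : Plane => Complex.ofReal (‖x‖ ^ 2))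
          fun_prop
    rw [h, sub_add_cancel_left, smul_neg, neg_smul, Complex.coe_smul]
  · apply toTemperedDistribution_injective
    rw [Lp.toTemperedDistribution_smul_eq (by fun_prop), ← Lp.fourier_toTemperedDistribution_eq,
      ← Lp.fourier_toTemperedDistribution_eq, ← hf,
      fourier_besselPotential_eq_smulLeftCLM_fourier_apply,
      smulLeftCLM_smulLeftCLM_apply (by fun_prop) (by fun_prop)]
    have h1 : (fun x : Plane => (((1 + ‖x‖ ^ 2) ^ (-1 : ℝ) : ℝ) : ℂ)) *
        (fun x : Plane => (((1 + ‖x‖ ^ 2) ^ ((2 : ℝ) / 2) : ℝ) : ℂ)) = fun _ => 1 := by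
      ext x
      have : (1 + ‖x‖ ^ 2) ≠ 0 := by positivity
      simp only [Pi.mul_apply]
      rw [← Complex.ofReal_mul, ← Real.rpow_add (by positivity)]
      simp
    rw [mul_comm, h1]
    simp

theorem laplacianL2_symmetric (u v : sobolevH2) :
    inner ℂ (laplacianL2 u) (v : L2) = inner ℂ (u : L2) (laplacianL2 v) := by
  obtain ⟨f, hf, hf'⟩ := exists_fourier_representation u
  obtain ⟨g, hg, hg'⟩ := exists_fourier_representation v
  have key : inner ℂ f (v : L2) = inner ℂ (u : L2) g := by
    rw [← Lp.inner_fourier_eq, ← Lp.inner_fourier_eq (u : L2), hf', hg', L2.inner_def, L2.inner_def]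
    apply integral_congr_ae
    have hm := memLp_top_symbol.coeFn_toLp
    have h1 : ∀ k : L2, ∀ᵐ x, (memLp_top_symbol.toLp _ • k : L2) x =
        (memLp_top_symbol.toLp _) x • k x := fun k => Lp.coeFn_lpSMul (r := 2) _ k
    filter_upwards [hm, h1 (𝓕 f), h1 (𝓕 g)] with x hx h2 h3
    rw [h2, h3, hx, smul_eq_mul, smul_eq_mul]
    simp only [RCLike.inner_apply, map_mul, Complex.conj_ofReal]
    ring
  rw [hf, hg, inner_smul_left, inner_smul_right, inner_sub_left, inner_sub_right, key,
    Complex.conj_ofReal]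

theorem mulPotential_symmetric (V : Plane → ℝ) (hV : MemLp V ∞ volume) (u v : L2) :
    inner ℂ (mulPotential V hV u) v = inner ℂ u (mulPotential V hV v) := by
  rw [L2.inner_def, L2.inner_def]
  apply integral_congr_ae
  filter_upwards [mulPotential_ae V hV u, mulPotential_ae V hV v] with x h1 h2
  rw [h1, h2]
  simp only [RCLike.inner_apply, map_mul, Complex.conj_ofReal]
  ring

theorem schrodingerOp_symmetric (V : Plane → ℝ) (hV : MemLp V ∞ volume)
    (u v : (schrodingerOp V hV).domain) :
    inner ℂ (schrodingerOp V hV u) (v : L2) = inner ℂ (u : L2) (schrodingerOp V hV v) := by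
  change inner ℂ (-laplacianL2 u - mulPotential V hV (u : L2)) (v : L2) =
    inner ℂ (u : L2) (-laplacianL2 v - mulPotential V hV (v : L2))
  rw [inner_sub_left, inner_sub_right, inner_neg_left, inner_neg_right]
  exact congrArg₂ (fun a b => -a - b) (laplacianL2_symmetric u v)
    (mulPotential_symmetric V hV (u : L2) v)

end Symmetry

/-! ### The quadratic form on test functions -/

section TestFunctions

open scoped LineDeriv

theorem memSobolev_toLp (w : 𝓢(Plane, ℂ)) :
    TemperedDistribution.MemSobolev 2 2 (Lp.toTemperedDistribution (w.toLp 2 volume)) := by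
  rw [Lp.toTemperedDistribution_toLp_eq]
  exact w.memSobolev

/-- A Schwartz function, as an element of `H²`. -/
noncomputable def schwartzToH2 (w : 𝓢(Plane, ℂ)) : sobolevH2 :=
  ⟨w.toLp 2 volume, memSobolev_toLp w⟩

theorem coe_schwartzToH2 (w : 𝓢(Plane, ℂ)) : (schwartzToH2 w : L2) = w.toLp 2 volume := rfl

theorem laplacianL2_schwartzToH2 (w : 𝓢(Plane, ℂ)) :
    laplacianL2 (schwartzToH2 w) = (Δ w).toLp 2 volume := by
  apply toTemperedDistribution_injective
  rw [laplacianL2_spec, coe_schwartzToH2, Lp.toTemperedDistribution_toLp_eq,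
    Lp.toTemperedDistribution_toLp_eq,
    TemperedDistribution.laplacian_toTemperedDistributionCLM_eq]

/-- A smooth compactly supported real function, as a complex Schwartz function. -/
noncomputable def realTest (u : Plane → ℝ) (hu : ContDiff ℝ (⊤ : ℕ∞) u) (hc : HasCompactSupport u) :
    𝓢(Plane, ℂ) :=
  HasCompactSupport.toSchwartzMap (f := fun x => (u x : ℂ)) (hc.comp_left (g := Complex.ofReal) rfl)
    (Complex.ofRealCLM.contDiff.comp hu)

variable {u v : Plane → ℝ} (hu : ContDiff ℝ (⊤ : ℕ∞) u) (hc : HasCompactSupport u)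
  (hv : ContDiff ℝ (⊤ : ℕ∞) v) (hd : HasCompactSupport v)

@[simp] theorem realTest_apply (x : Plane) : realTest u hu hc x = (u x : ℂ) := rfl

theorem inner_realTest_laplacian :
    inner ℂ ((realTest u hu hc).toLp 2 volume : L2) ((Δ (realTest v hv hd)).toLp 2 volume : L2) =
      ∫ x, (u x : ℂ) * Δ (realTest v hv hd) x := by
  rw [L2.inner_def]
  apply integral_congr_ae
  filter_upwards [(realTest u hu hc).coeFn_toLp 2 volume,
    (Δ (realTest v hv hd)).coeFn_toLp 2 volume] with x h1 h2
  rw [h1, h2, RCLike.inner_apply]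
  simp [mul_comm]

theorem inner_realTest_mulPotential (V : Plane → ℝ) (hV : MemLp V ∞ volume) :
    inner ℂ ((realTest u hu hc).toLp 2 volume : L2)
        (mulPotential V hV ((realTest v hv hd).toLp 2 volume : L2)) =
      ((∫ x, V x * (u x * v x) : ℝ) : ℂ) := by
  rw [L2.inner_def, ← integral_complex_ofReal]
  apply integral_congr_ae
  filter_upwards [(realTest u hu hc).coeFn_toLp 2 volume,
    (realTest v hv hd).coeFn_toLp 2 volume,
    mulPotential_ae V hV ((realTest v hv hd).toLp 2 volume : L2)] with x h1 h2 h3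
  rw [h1, h3, h2, RCLike.inner_apply]
  simp
  ring

theorem sum_sq_apply_orthonormalBasis {ι : Type*} [Fintype ι] (b : OrthonormalBasis ι ℝ Plane)
    (L : Plane →L[ℝ] ℝ) : ∑ i, (L (b i)) ^ 2 = ‖L‖ ^ 2 := by
  set g := (InnerProductSpace.toDual ℝ Plane).symm L with hg
  have h1 : ∀ y, inner ℝ g y = L y := fun y => InnerProductSpace.toDual_symm_apply
  have h2 : ‖g‖ = ‖L‖ := LinearIsometryEquiv.norm_map _ _
  rw [← h2, ← b.sum_sq_inner_left g]
  simp [h1]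

theorem lineDeriv_realTest (m x : Plane) :
    (∂_{m} (realTest u hu hc)) x = ((fderiv ℝ u x m : ℝ) : ℂ) := by
  rw [SchwartzMap.lineDerivOp_apply_eq_fderiv]
  have h1 : HasFDerivAt u (fderiv ℝ u x) x :=
    (hu.differentiable (by simp) x).hasFDerivAt
  have h2 : HasFDerivAt (fun y => (u y : ℂ)) (Complex.ofRealCLM.comp (fderiv ℝ u x)) x :=
    Complex.ofRealCLM.hasFDerivAt.comp x h1
  have h3 : fderiv ℝ (realTest u hu hc) x = _ := h2.fderiv
  rw [h3]
  rfl

theorem integral_mul_laplacian_self :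
    ∫ x, (u x : ℂ) * Δ (realTest u hu hc) x = ((-∫ x, ‖fderiv ℝ u x‖ ^ 2 : ℝ) : ℂ) := by
  set b := stdOrthonormalBasis ℝ Plane
  set w := realTest u hu hc with hw
  have hI : ∀ f g : 𝓢(Plane, ℂ), Integrable (fun x => f x * g x) := fun f g =>
    (SchwartzMap.pairing (ContinuousLinearMap.mul ℂ ℂ) f g).integrable
  have h1 : ∀ x, (u x : ℂ) * Δ w x = ∑ i, w x * (∂_{b i} (∂_{b i} w)) x := by
    intro x
    rw [SchwartzMap.laplacian_eq_sum b, _root_.sum_apply, Finset.mul_sum]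
    rfl
  simp_rw [h1]
  rw [integral_finsetSum _ fun i _ => hI _ _]
  have h2 : ∀ i, ∫ x, w x * (∂_{b i} (∂_{b i} w)) x = -∫ x, (∂_{b i} w) x * (∂_{b i} w) x :=
    fun i => SchwartzMap.integral_mul_lineDerivOp_right_eq_neg_left w (∂_{b i} w) (b i)
  rw [Finset.sum_congr rfl fun i _ => h2 i, Finset.sum_neg_distrib,
    ← integral_finsetSum _ fun i _ => hI _ _, Complex.ofReal_neg,
    ← integral_complex_ofReal]
  congr 1
  apply integral_congr_ae
  refine Filter.Eventually.of_forall fun x => ?_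
  simp only [hw, lineDeriv_realTest]
  rw [← sum_sq_apply_orthonormalBasis b]
  push_cast
  simp_rw [sq]

theorem integral_mul_laplacian_of_disjoint (h : Disjoint (tsupport u) (tsupport v)) :
    ∫ x, (u x : ℂ) * Δ (realTest v hv hd) x = 0 := by
  rw [← integral_zero Plane ℂ]
  congr 1
  ext x
  by_cases hx : x ∈ tsupport u
  · have hxv : x ∉ tsupport v := Set.disjoint_left.1 h hx
    have hev : (fun y => (v y : ℂ)) =ᶠ[nhds x] fun _ => 0 := by
      filter_upwards [(isClosed_tsupport v).isOpen_compl.mem_nhds hxv] with y hy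
      simp [image_eq_zero_of_notMem_tsupport hy]
    rw [SchwartzMap.laplacian_apply]
    have : Δ (⇑(realTest v hv hd)) x = Δ (fun _ : Plane => (0 : ℂ)) x :=
      (InnerProductSpace.laplacian_congr_nhds hev).eq_of_nhds
    rw [this]
    have h0 : Δ (fun _ : Plane => (0 : ℂ)) = 0 := by
      have := SchwartzMap.laplacian_apply (0 : 𝓢(Plane, ℂ))
      ext y
      have h2 := this y
      rw [← SchwartzMap.laplacianCLM_eq', map_zero] at h2
      exact h2.symm
    rw [h0]; simp
  · simp [image_eq_zero_of_notMem_tsupport hx]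

/-- `N + 1` smooth test functions with disjoint compact supports and negative energy cannot exist if
the negative spectrum of the Schrödinger operator consists of `N` eigenvalues. -/
theorem false_of_disjoint_negative_energy (V : Plane → ℝ) (hV : MemLp V ∞ volume) {N : ℕ}
    (hN : NegativeSpectrumConsistsOf (schrodingerOp V hV) N) (u : Fin (N + 1) → Plane → ℝ)
    (hu : ∀ i, ContDiff ℝ (⊤ : ℕ∞) (u i)) (hc : ∀ i, HasCompactSupport (u i))
    (hdis : ∀ i j, i ≠ j → Disjoint (tsupport (u i)) (tsupport (u j)))
    (hneg : ∀ i, ∫ x, ‖fderiv ℝ (u i) x‖ ^ 2 < ∫ x, V x * u i x ^ 2) : False := by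
  let T := schrodingerOp V hV
  let W : Fin (N + 1) → T.domain := fun i => schwartzToH2 (realTest (u i) (hu i) (hc i))
  have hq : ∀ i, (∫ x, ‖fderiv ℝ (u i) x‖ ^ 2) - ∫ x, V x * u i x ^ 2 < 0 := fun i =>
    sub_neg.2 (hneg i)
  have hTW : ∀ j, T (W j) = -(Δ (realTest (u j) (hu j) (hc j))).toLp 2 volume -
      mulPotential V hV ((realTest (u j) (hu j) (hc j)).toLp 2 volume : L2) := by
    intro j
    rw [← laplacianL2_schwartzToH2]
    rfl
  have hW : ∀ i j, inner ℂ (W i : L2) (T (W j)) = if i = j then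
      (((∫ x, ‖fderiv ℝ (u i) x‖ ^ 2) - ∫ x, V x * u i x ^ 2 : ℝ) : ℂ) else 0 := by
    intro i j
    have h0 : (W i : L2) = (realTest (u i) (hu i) (hc i)).toLp 2 volume := rfl
    rw [hTW, h0, inner_sub_right, inner_neg_right, inner_realTest_laplacian,
      inner_realTest_mulPotential]
    split_ifs with h
    · subst h
      rw [integral_mul_laplacian_self]
      push_cast
      simp [sq]
    · rw [integral_mul_laplacian_of_disjoint _ _ (hdis i j h)]
      have : ∀ x, V x * (u i x * u j x) = 0 := by
        intro x
        by_cases hx : x ∈ tsupport (u i)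
        · simp [image_eq_zero_of_notMem_tsupport (Set.disjoint_left.1 (hdis i j h) hx)]
        · simp [image_eq_zero_of_notMem_tsupport hx]
      simp [this]
  obtain ⟨a, ha, hnn⟩ := exists_ne_zero_form_nonneg T (schrodingerOp_symmetric V hV) hN
    (Fintype.linearCombination ℂ W)
  have hval : inner ℂ (T (Fintype.linearCombination ℂ W a))
      (Fintype.linearCombination ℂ W a : L2) = ((∑ i, ‖a i‖ ^ 2 *
        ((∫ x, ‖fderiv ℝ (u i) x‖ ^ 2) - ∫ x, V x * u i x ^ 2) : ℝ) : ℂ) := by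
    rw [schrodingerOp_symmetric, Fintype.linearCombination_apply]
    have e1 : ((∑ i, a i • W i : T.domain) : L2) = ∑ i, a i • (W i : L2) := by
      simp
    have e2 : T (∑ i, a i • W i) = ∑ i, a i • T (W i) := by
      have := map_sum T.toFun (fun i => a i • W i) Finset.univ
      simp_rw [map_smul] at this
      exact this
    rw [e1]
    change inner ℂ _ (T (∑ i, a i • W i)) = _
    rw [e2, sum_inner]
    push_cast
    refine Finset.sum_congr rfl fun i _ => ?_
    rw [inner_sum, Finset.sum_eq_single i]
    · rw [inner_smul_left, inner_smul_right, hW, if_pos rfl, ← mul_assoc, Complex.conj_mul']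
      push_cast
      rfl
    · intro j _ hj
      rw [inner_smul_left, inner_smul_right, hW, if_neg (Ne.symm hj)]
      simp
    · simp
  rw [hval, Complex.ofReal_re] at hnn
  obtain ⟨i, hi⟩ : ∃ i, a i ≠ 0 := Function.ne_iff.1 ha
  refine absurd hnn (not_le.2 ?_)
  refine Finset.sum_neg' (fun j _ => ?_) ⟨i, Finset.mem_univ _, ?_⟩
  · exact mul_nonpos_of_nonneg_of_nonpos (by positivity) (hq j).le
  · exact mul_neg_of_pos_of_neg (by positivity) (hq i)

end TestFunctions

/-! ### Squares -/

section Squares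

/-- The distance between two points of the plane in the maximum norm. -/
def maxDist (x y : Plane) : ℝ := max |y 0 - x 0| |y 1 - x 1|

/-- The closed square with centre `x` and side length `2 * r`. -/
def square (x : Plane) (r : ℝ) : Set Plane := {y | maxDist x y ≤ r}

theorem mem_square {x y : Plane} {r : ℝ} : y ∈ square x r ↔ maxDist x y ≤ r := Iff.rfl

theorem maxDist_nonneg (x y : Plane) : 0 ≤ maxDist x y := le_max_of_le_left (abs_nonneg _)

theorem continuous_maxDist (x : Plane) : Continuous (maxDist x) := by
  unfold maxDist
  fun_prop

theorem isClosed_square (x : Plane) (r : ℝ) : IsClosed (square x r) :=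
  isClosed_le (continuous_maxDist x) continuous_const

theorem measurableSet_square (x : Plane) (r : ℝ) : MeasurableSet (square x r) :=
  (isClosed_square x r).measurableSet

theorem square_mono (x : Plane) {r r' : ℝ} (h : r ≤ r') : square x r ⊆ square x r' :=
  fun _ hy => le_trans hy h

theorem abs_apply_sub_le_dist (y z : Plane) (i : Fin 2) : |y i - z i| ≤ dist y z := by
  rw [dist_eq_norm, ← Real.norm_eq_abs]
  exact PiLp.norm_apply_le (y - z) i

theorem abs_maxDist_sub_le (x y z : Plane) : |maxDist x y - maxDist x z| ≤ dist y z := by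
  refine (abs_max_sub_max_le_max _ _ _ _).trans (max_le ?_ ?_)
  · refine (abs_abs_sub_abs_le _ _).trans ?_
    rw [sub_sub_sub_cancel_right]
    exact abs_apply_sub_le_dist y z 0
  · refine (abs_abs_sub_abs_le _ _).trans ?_
    rw [sub_sub_sub_cancel_right]
    exact abs_apply_sub_le_dist y z 1

theorem dist_le_two_mul_maxDist (x y : Plane) : dist y x ≤ 2 * maxDist x y := by
  rw [EuclideanSpace.dist_eq, Fin.sum_univ_two, Real.dist_eq, Real.dist_eq]
  have h0 : |y 0 - x 0| ≤ maxDist x y := le_max_left _ _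
  have h1 : |y 1 - x 1| ≤ maxDist x y := le_max_right _ _
  have := maxDist_nonneg x y
  apply Real.sqrt_le_iff.2 ⟨by positivity, ?_⟩
  nlinarith [abs_nonneg (y 0 - x 0), abs_nonneg (y 1 - x 1)]

theorem volume_square (x : Plane) {r : ℝ} (hr : 0 ≤ r) :
    volume (square x r) = ENNReal.ofReal (4 * r ^ 2) := by
  have h1 : square x r = (WithLp.ofLp : Plane → Fin 2 → ℝ) ⁻¹'
      (Set.univ.pi fun i => Set.Icc (x i - r) (x i + r)) := by
    ext y
    simp only [mem_square, maxDist, max_le_iff, abs_le, Set.mem_preimage, Set.mem_univ_pi,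
      Set.mem_Icc, Fin.forall_fin_two]
    constructor
    · rintro ⟨⟨_, _⟩, _, _⟩; refine ⟨⟨?_, ?_⟩, ?_, ?_⟩ <;> linarith
    · rintro ⟨⟨_, _⟩, _, _⟩; refine ⟨⟨?_, ?_⟩, ?_, ?_⟩ <;> linarith
  rw [h1, (PiLp.volume_preserving_ofLp (Fin 2)).measure_preimage
    (MeasurableSet.univ_pi fun i => measurableSet_Icc).nullMeasurableSet, volume_pi_pi,
    Fin.prod_univ_two, Real.volume_Icc, Real.volume_Icc, ← ENNReal.ofReal_mul (by linarith)]
  congr 1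
  ring

theorem volume_square_ne_top (x : Plane) (r : ℝ) : volume (square x r) ≠ ∞ := by
  refine ne_top_of_le_ne_top ?_ (measure_mono (square_mono x (le_max_left r 0)))
  rw [volume_square x (le_max_right r 0)]
  exact ENNReal.ofReal_ne_top

theorem volume_real_square_sdiff (x : Plane) {a b : ℝ} (ha : 0 ≤ a) (hab : a ≤ b) :
    volume.real (square x b \ square x a) = 4 * (b ^ 2 - a ^ 2) := by
  rw [measureReal_sdiff (square_mono x hab) (measurableSet_square x a)
    (volume_square_ne_top x b), measureReal_def, measureReal_def, volume_square x ha,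
    volume_square x (ha.trans hab), ENNReal.toReal_ofReal (by positivity),
    ENNReal.toReal_ofReal (by positivity)]
  ring

/-- A square is covered by four squares of half its size. -/
theorem square_two_mul_subset (x : Plane) (r : ℝ) :
    ∃ c : Fin 4 → Plane, square x (2 * r) ⊆ ⋃ i, square (c i) r := by
  refine ⟨![!₂[x 0 - r, x 1 - r], !₂[x 0 - r, x 1 + r], !₂[x 0 + r, x 1 - r],
    !₂[x 0 + r, x 1 + r]], fun y hy => ?_⟩
  simp only [mem_square, maxDist, max_le_iff, abs_le] at hy
  obtain ⟨⟨h1, h2⟩, h3, h4⟩ := hy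
  simp only [Set.mem_iUnion, mem_square, maxDist, max_le_iff, abs_le, Fin.exists_fin_succ]
  rcases le_total (y 0) (x 0) with h0 | h0 <;> rcases le_total (y 1) (x 1) with h5 | h5
  · left; simp; refine ⟨⟨?_, ?_⟩, ?_, ?_⟩ <;> linarith
  · right; left; simp; refine ⟨⟨?_, ?_⟩, ?_, ?_⟩ <;> linarith
  · right; right; left; simp; refine ⟨⟨?_, ?_⟩, ?_, ?_⟩ <;> linarith
  · right; right; right; left; simp; refine ⟨⟨?_, ?_⟩, ?_, ?_⟩ <;> linarith

theorem hasCompactSupport_of_square {f : Plane → ℝ} {x : Plane} {r : ℝ}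
    (h : ∀ y, r < maxDist x y → f y = 0) : HasCompactSupport f := by
  refine HasCompactSupport.intro (isCompact_closedBall x (2 * r)) fun y hy => h y ?_
  rw [Metric.mem_closedBall, not_le] at hy
  linarith [dist_le_two_mul_maxDist x y]

end Squares

/-! ### Mollification -/

section Mollification

open Metric
open scoped Convolution

/-- Convolution with a bump function supported in the ball of radius `δ / 2`: the result has the
value `c` where `f` is constantly `c` on the ball of radius `δ`, and its gradient is bounded by any
Lipschitz constant of `f` on that ball. -/
theorem exists_mollification {f : Plane → ℝ} (hf : Continuous f) (hc : HasCompactSupport f)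
    {δ : ℝ} (hδ : 0 < δ) :
    ∃ u : Plane → ℝ, ContDiff ℝ (⊤ : ℕ∞) u ∧ HasCompactSupport u ∧
      (∀ y c, (∀ z ∈ ball y δ, f z = c) → u y = c) ∧
      ∀ y K, 0 ≤ K → (∀ z ∈ ball y δ, ∀ w ∈ ball y δ, |f z - f w| ≤ K * dist z w) →
        ‖fderiv ℝ u y‖ ≤ K := by
  let φ : ContDiffBump (0 : Plane) := ⟨δ / 4, δ / 2, by positivity, by linarith⟩
  have hconv : ∀ y, ConvolutionExistsAt (φ.normed volume) f y
      (ContinuousLinearMap.lsmul ℝ ℝ) volume := fun y =>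
    φ.hasCompactSupport_normed.convolutionExists_left _ φ.continuous_normed
      hf.locallyIntegrable y
  refine ⟨φ.normed volume ⋆[ContinuousLinearMap.lsmul ℝ ℝ, volume] f,
    φ.hasCompactSupport_normed.contDiff_convolution_left _ φ.contDiff_normed
      hf.locallyIntegrable, φ.hasCompactSupport_normed.convolution _ hc, ?_, ?_⟩
  · intro y c h
    have hy : f y = c := h y (mem_ball_self hδ)
    rw [φ.normed_convolution_eq_right, hy]
    intro z hz
    rw [hy]
    exact h z (ball_subset_ball (by change δ / 2 ≤ δ; linarith) hz)
  · intro y K hK h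
    refine norm_fderiv_le_of_lip' ℝ hK ?_
    filter_upwards [ball_mem_nhds y (show 0 < δ / 2 by positivity)] with z hz
    rw [convolution_def, convolution_def, ← integral_sub (hconv z) (hconv y)]
    have hint : ∫ t, φ.normed volume t * (K * ‖z - y‖) = K * ‖z - y‖ := by
      rw [integral_mul_const, φ.integral_normed, one_mul]
    rw [← hint]
    refine norm_integral_le_of_norm_le (φ.integrable_normed.mul_const _)
      (Filter.Eventually.of_forall fun t => ?_)
    simp only [ContinuousLinearMap.lsmul_apply, smul_eq_mul]
    rw [← mul_sub, norm_mul, Real.norm_of_nonneg (φ.nonneg_normed t), Real.norm_eq_abs]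
    by_cases ht : t ∈ ball (0 : Plane) (δ / 2)
    · refine mul_le_mul_of_nonneg_left ?_ (φ.nonneg_normed t)
      rw [mem_ball_zero_iff] at ht
      rw [mem_ball, dist_eq_norm] at hz
      have h1 := h (z - t) ?_ (y - t) ?_
      · rwa [dist_eq_norm, sub_sub_sub_cancel_right] at h1
      · rw [mem_ball, dist_eq_norm]
        calc ‖z - t - y‖ = ‖(z - y) - t‖ := by congr 1; abel
          _ ≤ ‖z - y‖ + ‖t‖ := norm_sub_le _ _
          _ < δ := by linarith
      · rw [mem_ball, dist_eq_norm]
        calc ‖y - t - y‖ = ‖t‖ := by rw [sub_sub_cancel_left, norm_neg]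
          _ < δ := by linarith
    · have h0 : φ.normed volume t = 0 := by
        by_contra h0
        have : t ∈ Function.support (φ.normed volume) := h0
        rw [φ.support_normed_eq] at this
        exact ht this
      simp [h0]

end Mollification

/-! ### Selection of squares of large mass -/

section Greedy

/-- A measure dominated by a multiple of Lebesgue measure, and of total mass greater than `T`, has a
square of mass at least `T` whose `19/10`-fold dilation has mass at most `4 * T`. -/
theorem exists_square_doubling {ν : Measure Plane} {C : ℝ} (hC : 0 < C)
    (hν : ν ≤ ENNReal.ofReal C • volume) {T : ℝ} (hT : 0 < T)
    (hmass : ENNReal.ofReal T < ν Set.univ) :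
    ∃ (x : Plane) (r : ℝ), 0 < r ∧ ENNReal.ofReal T ≤ ν (square x r) ∧
      ν (square x (1.9 * r)) ≤ ENNReal.ofReal (4 * T) := by
  -- the sizes of squares of mass at least `T` are bounded below; take one close to their infimum
  set I : Set ℝ := {r | 0 < r ∧ ∃ x, ENNReal.ofReal T ≤ ν (square x r)} with hI
  have hne : I.Nonempty := by
    have hU : (Set.univ : Set Plane) = ⋃ n : ℕ, square 0 (n : ℝ) := by
      refine (Set.eq_univ_of_forall fun y => ?_).symm
      obtain ⟨n, hn⟩ := exists_nat_ge (maxDist 0 y)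
      exact Set.mem_iUnion.2 ⟨n, hn⟩
    have hmono : Monotone fun n : ℕ => square (0 : Plane) (n : ℝ) := fun a b hab =>
      square_mono 0 (by exact_mod_cast hab)
    rw [hU, hmono.measure_iUnion] at hmass
    obtain ⟨n, hn⟩ := lt_iSup_iff.1 hmass
    refine ⟨(n : ℝ) + 1, by positivity, 0, hn.le.trans (measure_mono (square_mono 0 ?_))⟩
    linarith
  have hlow : ∀ r ∈ I, T / (4 * C) ≤ r ^ 2 := by
    rintro r ⟨hr, x, hx⟩
    have h1 : ν (square x r) ≤ ENNReal.ofReal (C * (4 * r ^ 2)) := by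
      rw [ENNReal.ofReal_mul hC.le, ← volume_square x hr.le]
      exact hν _
    have h2 := (ENNReal.ofReal_le_ofReal_iff (by positivity)).1 (hx.trans h1)
    rw [div_le_iff₀ (by positivity)]
    linarith
  have hbdd : BddBelow I := ⟨0, fun r hr => hr.1.le⟩
  have hpos : 0 < sInf I := by
    have h0 : 0 < Real.sqrt (T / (4 * C)) := Real.sqrt_pos.2 (by positivity)
    exact h0.trans_le (le_csInf hne fun r hr => (Real.sqrt_le_left hr.1.le).2 (hlow r hr))
  obtain ⟨r, hrI, hr⟩ := exists_lt_of_csInf_lt hne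
    (show sInf I < 20 / 19 * sInf I by linarith)
  obtain ⟨hr0, x, hx⟩ := hrI
  refine ⟨x, r, hr0, hx, ?_⟩
  obtain ⟨c, hc⟩ := square_two_mul_subset x (19 / 20 * r)
  rw [show 2 * (19 / 20 * r) = 1.9 * r by ring] at hc
  have hsmall : ∀ i, ν (square (c i) (19 / 20 * r)) ≤ ENNReal.ofReal T := by
    intro i
    by_contra! h
    have := csInf_le hbdd (show 19 / 20 * r ∈ I from ⟨by positivity, c i, h.le⟩)
    linarith
  calc ν (square x (1.9 * r)) ≤ ν (⋃ i, square (c i) (19 / 20 * r)) := measure_mono hc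
    _ ≤ ∑ i, ν (square (c i) (19 / 20 * r)) := measure_iUnion_fintype_le _ _
    _ ≤ ∑ _i : Fin 4, ENNReal.ofReal T := Finset.sum_le_sum fun i _ => hsmall i
    _ = ENNReal.ofReal (4 * T) := by
      rw [ENNReal.ofReal_mul (by norm_num)]
      simp

/-- The part of the plane covered by the `1.9`-fold dilations of the first `n` squares. -/
def swept (x : ℕ → Plane) (r : ℕ → ℝ) (n : ℕ) : Set Plane :=
  ⋃ k ∈ Finset.range n, square (x k) (1.9 * r k)

theorem measurableSet_swept (x : ℕ → Plane) (r : ℕ → ℝ) (n : ℕ) : MeasurableSet (swept x r n) :=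
  Finset.measurableSet_biUnion _ fun _ _ => measurableSet_square _ _

theorem swept_succ (x : ℕ → Plane) (r : ℕ → ℝ) (n : ℕ) :
    swept x r (n + 1) = square (x n) (1.9 * r n) ∪ swept x r n := by
  simp [swept, Finset.range_add_one]

theorem swept_congr {x x' : ℕ → Plane} {r r' : ℕ → ℝ} {n : ℕ}
    (hx : ∀ k < n, x k = x' k) (hr : ∀ k < n, r k = r' k) : swept x r n = swept x' r' n := by
  unfold swept
  refine Set.iUnion₂_congr fun k hk => ?_
  rw [hx k (Finset.mem_range.1 hk), hr k (Finset.mem_range.1 hk)]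

/-- Squares chosen one after the other, each of mass at least `T` outside the `1.9`-fold dilations
of the previous ones. -/
theorem exists_squares {μ : Measure Plane} {C : ℝ} (hC : 0 < C)
    (hμ : μ ≤ ENNReal.ofReal C • volume) {T : ℝ} (hT : 0 < T) (p : ℕ)
    (hmass : ENNReal.ofReal (p * (4 * T)) < μ Set.univ) :
    ∃ (x : ℕ → Plane) (r : ℕ → ℝ), μ (swept x r p) ≤ ENNReal.ofReal (p * (4 * T)) ∧
      ∀ k < p, 0 < r k ∧ ENNReal.ofReal T ≤ μ (square (x k) (r k) \ swept x r k) := by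
  induction p with
  | zero => exact ⟨fun _ => 0, fun _ => 0, by simp [swept], by simp⟩
  | succ p ih =>
    have hlt : ENNReal.ofReal (p * (4 * T)) < μ Set.univ := by
      refine lt_of_le_of_lt (ENNReal.ofReal_le_ofReal ?_) hmass
      push_cast
      nlinarith
    obtain ⟨x, r, hs, hk⟩ := ih hlt
    have hνT : ENNReal.ofReal T < μ.restrict (swept x r p)ᶜ Set.univ := by
      rw [Measure.restrict_apply_univ]
      by_contra! h
      have h1 : μ Set.univ ≤ ENNReal.ofReal (p * (4 * T)) + ENNReal.ofReal T := by
        rw [← measure_add_measure_compl (measurableSet_swept x r p)]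
        exact add_le_add hs h
      rw [← ENNReal.ofReal_add (by positivity) hT.le] at h1
      refine absurd (h1.trans_lt' hmass) (not_lt.2 (ENNReal.ofReal_le_ofReal ?_))
      push_cast
      linarith
    obtain ⟨y, s, hs0, hsT, hs4⟩ := exists_square_doubling hC
      (Measure.restrict_le_self.trans hμ) hT hνT
    have ex : ∀ k < p, Function.update x p y k = x k := fun k hk =>
      Function.update_of_ne hk.ne _ _
    have er : ∀ k < p, Function.update r p s k = r k := fun k hk =>
      Function.update_of_ne hk.ne _ _
    have esw : ∀ n ≤ p, swept (Function.update x p y) (Function.update r p s) n = swept x r n :=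
      fun n hn => swept_congr (fun k hk => ex k (hk.trans_le hn)) fun k hk => er k (hk.trans_le hn)
    refine ⟨Function.update x p y, Function.update r p s, ?_, fun k hkp => ?_⟩
    · rw [swept_succ, esw p le_rfl, Function.update_self, Function.update_self]
      have h1 : square y (1.9 * s) ∪ swept x r p =
          (square y (1.9 * s) ∩ (swept x r p)ᶜ) ∪ swept x r p := by
        ext z; by_cases hz : z ∈ swept x r p <;> simp [hz]
      rw [h1]
      refine (measure_union_le _ _).trans ?_
      rw [Measure.restrict_apply (measurableSet_square y _)] at hs4
      refine (add_le_add hs4 hs).trans ?_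
      rw [← ENNReal.ofReal_add (by positivity) (by positivity)]
      refine ENNReal.ofReal_le_ofReal ?_
      push_cast
      linarith
    · rw [esw k (Nat.lt_succ_iff.1 hkp)]
      rcases Nat.lt_succ_iff_lt_or_eq.1 hkp with h | rfl
      · rw [ex k h, er k h]
        exact hk k h
      · rw [Function.update_self, Function.update_self]
        refine ⟨hs0, ?_⟩
        rw [Measure.restrict_apply (measurableSet_square y _)] at hsT
        exact hsT

end Greedy

/-! ### Cutoffs and test functions -/

section Cutoffs

open Metric

/-- The piecewise linear function with value `1` on `(-∞, a]` and value `0` on `[b, ∞)`. -/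
noncomputable def ramp (a b t : ℝ) : ℝ := max 0 (min 1 ((b - t) / (b - a)))

theorem ramp_nonneg (a b t : ℝ) : 0 ≤ ramp a b t := le_max_left _ _

theorem ramp_le_one (a b t : ℝ) : ramp a b t ≤ 1 := max_le zero_le_one (min_le_left _ _)

theorem ramp_eq_one {a b t : ℝ} (hab : a < b) (h : t ≤ a) : ramp a b t = 1 := by
  have : 1 ≤ (b - t) / (b - a) := by rw [le_div_iff₀ (by linarith)]; linarith
  rw [ramp, min_eq_left this, max_eq_right zero_le_one]

theorem ramp_eq_zero {a b t : ℝ} (hab : a < b) (h : b ≤ t) : ramp a b t = 0 := by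
  have : (b - t) / (b - a) ≤ 0 := div_nonpos_of_nonpos_of_nonneg (by linarith) (by linarith)
  rw [ramp, min_eq_right (this.trans zero_le_one), max_eq_left this]

theorem continuous_ramp (a b : ℝ) : Continuous (ramp a b) := by
  unfold ramp
  fun_prop

theorem abs_ramp_sub_le {a b : ℝ} (hab : a < b) (s t : ℝ) :
    |ramp a b s - ramp a b t| ≤ |s - t| / (b - a) := by
  have h0 : 0 < b - a := by linarith
  have h1 : |(b - s) / (b - a) - (b - t) / (b - a)| = |s - t| / (b - a) := by
    rw [← sub_div, abs_div, abs_of_pos h0, sub_sub_sub_cancel_left, abs_sub_comm]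
  rw [← h1]
  refine (abs_max_sub_max_le_max _ _ _ _).trans (max_le (by simp) ?_)
  refine (abs_min_sub_min_le_max _ _ _ _).trans (max_le (by simp) le_rfl)

/-- The cutoff with value `1` on the square of size `(a + 0.01) * r`, value `0` off the square of
size `(b - 0.01) * r`, and piecewise linear in the distance to the centre. -/
noncomputable def cutoff (x : Plane) (r a b : ℝ) (y : Plane) : ℝ :=
  ramp (a + 0.01) (b - 0.01) (maxDist x y / r)

/-- The square annulus between the sizes `a * r` and `b * r`. -/
def annulus (x : Plane) (r a b : ℝ) : Set Plane := square x (b * r) \ square x (a * r)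

/-- The slope of `cutoff x r a b`. -/
noncomputable def cutoffSlope (r a b : ℝ) : ℝ := 1 / ((b - a - 0.02) * r)

variable {x : Plane} {r a b : ℝ}

theorem measurableSet_annulus (x : Plane) (r a b : ℝ) : MeasurableSet (annulus x r a b) :=
  (measurableSet_square _ _).diff (measurableSet_square _ _)

theorem volume_annulus_ne_top (x : Plane) (r a b : ℝ) : volume (annulus x r a b) ≠ ∞ :=
  ne_top_of_le_ne_top (volume_square_ne_top x (b * r)) (measure_mono Set.sdiff_subset)

/-- The product of the squared slope and the area does not depend on the size of the annulus: the
Dirichlet energy is scale invariant in the plane. -/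
theorem cutoffSlope_sq_mul_volume_annulus (hr : 0 < r) (ha : 0 ≤ a) (hab : a + 0.02 < b) :
    cutoffSlope r a b ^ 2 * volume.real (annulus x r a b) =
      4 * (b ^ 2 - a ^ 2) / (b - a - 0.02) ^ 2 := by
  have h0 : b - a - 0.02 ≠ 0 := by linarith
  rw [annulus, volume_real_square_sdiff x (by positivity) (by gcongr; linarith), cutoffSlope]
  field_simp

theorem continuous_cutoff (x : Plane) (r a b : ℝ) : Continuous (cutoff x r a b) :=
  (continuous_ramp _ _).comp ((continuous_maxDist x).div_const r)

theorem cutoffSlope_pos (hr : 0 < r) (hab : a + 0.02 < b) : 0 < cutoffSlope r a b := by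
  have : 0 < b - a - 0.02 := by linarith
  unfold cutoffSlope
  positivity

theorem cutoff_eq_one (hr : 0 < r) (hab : a + 0.02 < b) {y : Plane}
    (h : maxDist x y ≤ (a + 0.01) * r) : cutoff x r a b y = 1 :=
  ramp_eq_one (by linarith) (by rwa [div_le_iff₀ hr])

theorem cutoff_eq_zero (hr : 0 < r) (hab : a + 0.02 < b) {y : Plane}
    (h : (b - 0.01) * r ≤ maxDist x y) : cutoff x r a b y = 0 :=
  ramp_eq_zero (by linarith) (by rwa [le_div_iff₀ hr])

theorem abs_maxDist_sub_lt {x y z : Plane} {δ : ℝ} (hz : z ∈ ball y δ) :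
    |maxDist x z - maxDist x y| < δ :=
  (abs_maxDist_sub_le x z y).trans_lt (mem_ball.1 hz)

/-- Near a point off the annulus the cutoff is constant. -/
theorem cutoff_lipschitz (hr : 0 < r) (hab : a + 0.02 < b) {δ : ℝ} (hδ : δ ≤ 0.005 * r)
    (y : Plane) {z w : Plane} (hz : z ∈ ball y δ) (hw : w ∈ ball y δ) :
    |cutoff x r a b z - cutoff x r a b w| ≤
      (annulus x r a b).indicator (fun _ => cutoffSlope r a b) y * dist z w := by
  have hz' := abs_lt.1 (abs_maxDist_sub_lt (x := x) hz)
  have hw' := abs_lt.1 (abs_maxDist_sub_lt (x := x) hw)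
  by_cases hy : y ∈ annulus x r a b
  · rw [Set.indicator_of_mem hy]
    have h0 : 0 < b - a - 0.02 := by linarith
    refine (abs_ramp_sub_le (by linarith) _ _).trans ?_
    rw [← sub_div, abs_div, abs_of_pos hr, cutoffSlope, div_div, one_div_mul_eq_div]
    rw [show r * (b - 0.01 - (a + 0.01)) = (b - a - 0.02) * r by ring]
    gcongr
    exact abs_maxDist_sub_le x z w
  · rw [Set.indicator_of_notMem hy, zero_mul]
    rw [annulus, Set.mem_sdiff, not_and_or, not_not, mem_square, mem_square, not_le] at hy
    rcases hy with hy | hy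
    · rw [cutoff_eq_zero hr hab (by linarith), cutoff_eq_zero hr hab (by linarith)]
      simp
    · rw [cutoff_eq_one hr hab (by linarith), cutoff_eq_one hr hab (by linarith)]
      simp

/-- The minimum of `o` and `h 0, …, h (n - 1)`. -/
noncomputable def cutMin (o : Plane → ℝ) (h : ℕ → Plane → ℝ) : ℕ → Plane → ℝ
  | 0 => o
  | n + 1 => fun y => min (cutMin o h n y) (h n y)

theorem cutMin_le_left (o : Plane → ℝ) (h : ℕ → Plane → ℝ) (n : ℕ) (y : Plane) :
    cutMin o h n y ≤ o y := by
  induction n with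
  | zero => exact le_rfl
  | succ n ih => exact (min_le_left _ _).trans ih

theorem cutMin_le (o : Plane → ℝ) (h : ℕ → Plane → ℝ) (n : ℕ) (y : Plane) {k : ℕ} (hk : k < n) :
    cutMin o h n y ≤ h k y := by
  induction n with
  | zero => omega
  | succ n ih =>
    rcases Nat.lt_succ_iff_lt_or_eq.1 hk with hk | rfl
    · exact (min_le_left _ _).trans (ih hk)
    · exact min_le_right _ _

theorem le_cutMin {o : Plane → ℝ} {h : ℕ → Plane → ℝ} {n : ℕ} {y : Plane} {c : ℝ} (ho : c ≤ o y)
    (hh : ∀ k < n, c ≤ h k y) : c ≤ cutMin o h n y := by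
  induction n with
  | zero => exact ho
  | succ n ih => exact le_min (ih fun k hk => hh k (hk.trans n.lt_succ_self)) (hh n n.lt_succ_self)

theorem continuous_cutMin {o : Plane → ℝ} {h : ℕ → Plane → ℝ} (n : ℕ) (ho : Continuous o)
    (hh : ∀ k, Continuous (h k)) : Continuous (cutMin o h n) := by
  induction n with
  | zero => exact ho
  | succ n ih => exact ih.min (hh n)

/-- A Lipschitz constant of a minimum is the largest of the individual ones, so its square is at
most the sum of their squares: overlapping cutoffs do not produce cross terms. -/
theorem cutMin_lipschitz {o : Plane → ℝ} {h : ℕ → Plane → ℝ} {s : Set Plane} {K₀ : ℝ} {K : ℕ → ℝ}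
    (n : ℕ) (hK₀ : 0 ≤ K₀) (ho : ∀ z ∈ s, ∀ w ∈ s, |o z - o w| ≤ K₀ * dist z w)
    (hh : ∀ k < n, ∀ z ∈ s, ∀ w ∈ s, |h k z - h k w| ≤ K k * dist z w) :
    ∃ L, 0 ≤ L ∧ L ^ 2 ≤ K₀ ^ 2 + ∑ k ∈ Finset.range n, K k ^ 2 ∧
      ∀ z ∈ s, ∀ w ∈ s, |cutMin o h n z - cutMin o h n w| ≤ L * dist z w := by
  induction n with
  | zero => exact ⟨K₀, hK₀, by simp, ho⟩
  | succ n ih =>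
    obtain ⟨L, hL, hL2, hLip⟩ := ih fun k hk => hh k (hk.trans n.lt_succ_self)
    refine ⟨max L (K n), le_max_of_le_left hL, ?_, fun z hz w hw => ?_⟩
    · rw [Finset.sum_range_succ]
      rcases le_total L (K n) with h1 | h1
      · rw [max_eq_right h1]; nlinarith [sq_nonneg L]
      · rw [max_eq_left h1]; nlinarith [sq_nonneg (K n)]
    · refine (abs_min_sub_min_le_max _ _ _ _).trans (max_le ?_ ?_)
      · exact (hLip z hz w hw).trans (by gcongr; exact le_max_left _ _)
      · exact (hh n n.lt_succ_self z hz w hw).trans (by gcongr; exact le_max_right _ _)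

theorem integrable_indicator_annulus (x : Plane) (r a b q : ℝ) {D : Set Plane}
    (hD : MeasurableSet D) :
    Integrable ((annulus x r a b ∩ D).indicator fun _ => q) volume := by
  have hfin : volume (annulus x r a b ∩ D) ≠ ∞ :=
    ne_top_of_le_ne_top (volume_annulus_ne_top x r a b) (measure_mono Set.inter_subset_left)
  exact (integrableOn_const hfin).integrable_indicator
    ((measurableSet_annulus x r a b).inter hD)

/-- The region where the `i`-th test function lives: the `7/5`-fold dilation of the `i`-th square,
without those of the previous squares. -/
def cell (x : ℕ → Plane) (r : ℕ → ℝ) (i : ℕ) : Set Plane :=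
  {y | maxDist (x i) y < 1.4 * r i ∧ ∀ k < i, 1.4 * r k ≤ maxDist (x k) y}

theorem measurableSet_cell (x : ℕ → Plane) (r : ℕ → ℝ) (i : ℕ) : MeasurableSet (cell x r i) := by
  have h1 : MeasurableSet {y | maxDist (x i) y < 1.4 * r i} :=
    (isOpen_lt (continuous_maxDist _) continuous_const).measurableSet
  have h2 : ∀ k, MeasurableSet {y | k < i → 1.4 * r k ≤ maxDist (x k) y} := fun k => by
    by_cases hk : k < i
    · simpa [hk] using (isClosed_le continuous_const (continuous_maxDist (x k))).measurableSet
    · simp [hk]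
  have h3 : cell x r i = {y | maxDist (x i) y < 1.4 * r i} ∩
      ⋂ k, {y | k < i → 1.4 * r k ≤ maxDist (x k) y} := by
    ext y; simp [cell]
  rw [h3]
  exact h1.inter (MeasurableSet.iInter h2)

theorem disjoint_cell (x : ℕ → Plane) (r : ℕ → ℝ) {i j : ℕ} (hij : i ≠ j) :
    Disjoint (cell x r i) (cell x r j) := by
  rw [Set.disjoint_left]
  rintro y ⟨h1, h2⟩ ⟨h3, h4⟩
  rcases lt_or_gt_of_ne hij with h | h
  · exact absurd h1 (not_lt.2 (h4 i h))
  · exact absurd h3 (not_lt.2 (h2 j h))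

/-- The bound for the contribution to the `i`-th Dirichlet energy of the holes around the previous
squares. -/
noncomputable def holeEnergy (x : ℕ → Plane) (r : ℕ → ℝ) (i : ℕ) : ℝ :=
  ∑ k ∈ Finset.range i, cutoffSlope (r k) 1.4 1.9 ^ 2 *
    volume.real (annulus (x k) (r k) 1.4 1.9 ∩ cell x r i)

/-- Since the cells are disjoint, the annulus around each square is counted at most once, and it
contributes at most `4 * (1.9 ^ 2 - 1.4 ^ 2) / 0.48 ^ 2 ≤ 28.7`. -/
theorem sum_holeEnergy_le (x : ℕ → Plane) (r : ℕ → ℝ) (n : ℕ) (hr : ∀ k < n, 0 < r k) :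
    ∑ i ∈ Finset.range (n + 1), holeEnergy x r i ≤ n * 28.7 := by
  calc ∑ i ∈ Finset.range (n + 1), holeEnergy x r i
      ≤ ∑ i ∈ Finset.range (n + 1), ∑ k ∈ Finset.range n, cutoffSlope (r k) 1.4 1.9 ^ 2 *
          volume.real (annulus (x k) (r k) 1.4 1.9 ∩ cell x r i) := by
        refine Finset.sum_le_sum fun i hi => ?_
        refine Finset.sum_le_sum_of_subset_of_nonneg ?_ fun _ _ _ => by positivity
        intro k hk
        simp only [Finset.mem_range] at *
        omega
    _ = ∑ k ∈ Finset.range n, cutoffSlope (r k) 1.4 1.9 ^ 2 *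
          ∑ i ∈ Finset.range (n + 1), volume.real (annulus (x k) (r k) 1.4 1.9 ∩ cell x r i) := by
        rw [Finset.sum_comm]
        simp_rw [Finset.mul_sum]
    _ ≤ ∑ k ∈ Finset.range n, cutoffSlope (r k) 1.4 1.9 ^ 2 *
          volume.real (annulus (x k) (r k) 1.4 1.9) := by
        refine Finset.sum_le_sum fun k hk => mul_le_mul_of_nonneg_left ?_ (by positivity)
        rw [← measureReal_biUnion_finset
          (fun i _ j _ hij => (disjoint_cell x r hij).mono Set.inter_subset_right
            Set.inter_subset_right)
          (fun i _ => (measurableSet_annulus _ _ _ _).inter (measurableSet_cell x r i))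
          (fun i _ => ne_top_of_le_ne_top (volume_annulus_ne_top _ _ _ _)
            (measure_mono Set.inter_subset_left))]
        exact measureReal_mono (Set.iUnion₂_subset fun _ _ => Set.inter_subset_left)
          (volume_annulus_ne_top _ _ _ _)
    _ ≤ ∑ _k ∈ Finset.range n, (28.7 : ℝ) := by
        refine Finset.sum_le_sum fun k hk => ?_
        rw [cutoffSlope_sq_mul_volume_annulus (hr k (Finset.mem_range.1 hk)) (by norm_num)
          (by norm_num)]
        norm_num
    _ = n * 28.7 := by simp

/-- The `i`-th test function: a mollification of the minimum of an outer cutoff around the `i`-th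
square and of cutoffs removing the `7/5`-fold dilations of the previous squares. The outer cutoff
contributes `4 * (1.4 ^ 2 - 1 ^ 2) / 0.38 ^ 2 ≤ 26.6` to its Dirichlet energy. -/
theorem exists_testFunction (x : ℕ → Plane) (r : ℕ → ℝ) (i : ℕ) (hr : ∀ k ≤ i, 0 < r k) :
    ∃ u : Plane → ℝ, ContDiff ℝ (⊤ : ℕ∞) u ∧ HasCompactSupport u ∧
      (∀ y ∈ tsupport u, maxDist (x i) y ≤ 1.395 * r i ∧
        ∀ k < i, 1.405 * r k ≤ maxDist (x k) y) ∧
      (∀ y ∈ square (x i) (r i) \ swept x r i, u y = 1) ∧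
      ∫ y, ‖fderiv ℝ u y‖ ^ 2 ≤ 26.6 + holeEnergy x r i := by
  -- `δ` is smaller than the margins left between the cutoffs and the boundaries of the annuli
  obtain ⟨δ, hδ0, hδ⟩ : ∃ δ > 0, ∀ k ≤ i, δ ≤ 0.005 * r k := by
    refine ⟨0.005 * (Finset.range (i + 1)).inf' ⟨0, by simp⟩ r, ?_, fun k hk => ?_⟩
    · refine mul_pos (by norm_num) ((Finset.lt_inf'_iff _).2 fun k hk => hr k ?_)
      exact Nat.lt_succ_iff.1 (Finset.mem_range.1 hk)
    · refine mul_le_mul_of_nonneg_left (Finset.inf'_le r ?_) (by norm_num)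
      exact Finset.mem_range.2 (Nat.lt_succ_iff.2 hk)
  have hri := hr i le_rfl
  let o : Plane → ℝ := cutoff (x i) (r i) 1 1.4
  let h : ℕ → Plane → ℝ := fun k y => 1 - cutoff (x k) (r k) 1.4 1.9 y
  let f := cutMin o h i
  have hf0 : ∀ y, 0 ≤ f y := fun y => le_cutMin (ramp_nonneg _ _ _)
    fun k _ => sub_nonneg.2 (ramp_le_one _ _ _)
  have hf1 : ∀ y, f y ≤ 1 := fun y => (cutMin_le_left o h i y).trans (ramp_le_one _ _ _)
  have hfo : ∀ y, 1.39 * r i ≤ maxDist (x i) y → f y = 0 := by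
    intro y hy
    refine le_antisymm ((cutMin_le_left o h i y).trans ?_) (hf0 y)
    exact (cutoff_eq_zero hri (by norm_num) (by linarith)).le
  have hfh : ∀ k < i, ∀ y, maxDist (x k) y ≤ 1.41 * r k → f y = 0 := by
    intro k hk y hy
    refine le_antisymm ((cutMin_le o h i y hk).trans ?_) (hf0 y)
    have : cutoff (x k) (r k) 1.4 1.9 y = 1 :=
      cutoff_eq_one (hr k hk.le) (by norm_num) (by linarith)
    simp [h, this]
  have hfc : Continuous f := continuous_cutMin i (continuous_cutoff _ _ _ _)
    fun k => continuous_const.sub (continuous_cutoff _ _ _ _)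
  obtain ⟨u, hu, huc, hconst, hlip⟩ := exists_mollification hfc
    (hasCompactSupport_of_square fun y hy => hfo y hy.le) hδ0
  have hnear : ∀ {y z : Plane} (k : ℕ), z ∈ ball y δ →
      maxDist (x k) y - δ < maxDist (x k) z ∧ maxDist (x k) z < maxDist (x k) y + δ := by
    intro y z k hz
    have := abs_lt.1 (abs_maxDist_sub_lt (x := x k) hz)
    constructor <;> linarith
  refine ⟨u, hu, huc, ?_, ?_, ?_⟩
  · have hclosed : IsClosed {y | maxDist (x i) y ≤ 1.395 * r i ∧
        ∀ k < i, 1.405 * r k ≤ maxDist (x k) y} := by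
      simp only [Set.ofPred_and, Set.ofPred_forall]
      exact (isClosed_le (continuous_maxDist _) continuous_const).inter
        (isClosed_iInter fun k => isClosed_iInter fun _ =>
          isClosed_le continuous_const (continuous_maxDist _))
    refine fun y hy => closure_minimal (fun y hy => ?_) hclosed hy
    by_contra hcon
    apply hy
    refine hconst y 0 fun z hz => ?_
    rw [Set.mem_ofPred_eq, not_and_or] at hcon
    rcases hcon with hcon | hcon
    · refine hfo z ?_
      have := hnear i hz
      have := hδ i le_rfl
      linarith
    · push Not at hcon
      obtain ⟨k, hk, hky⟩ := hcon
      refine hfh k hk z ?_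
      have := hnear k hz
      have := hδ k hk.le
      linarith
  · rintro y ⟨hy, hys⟩
    refine hconst y 1 fun z hz => le_antisymm (hf1 z) (le_cutMin ?_ fun k hk => ?_)
    · refine (cutoff_eq_one hri (by norm_num) ?_).ge
      have := hnear i hz
      have := hδ i le_rfl
      rw [mem_square] at hy
      linarith
    · have hky : 1.9 * r k < maxDist (x k) y := by
        by_contra! hcon
        exact hys (Set.mem_biUnion (Finset.mem_range.2 hk) hcon)
      have : cutoff (x k) (r k) 1.4 1.9 z = 0 := by
        refine cutoff_eq_zero (hr k hk.le) (by norm_num) ?_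
        have := hnear k hz
        have := hδ k hk.le
        linarith
      simp [h, this]
  · let So := annulus (x i) (r i) 1 1.4 ∩ Set.univ
    let S : ℕ → Set Plane := fun k => annulus (x k) (r k) 1.4 1.9 ∩ cell x r i
    let G : Plane → ℝ := fun y => So.indicator (fun _ => cutoffSlope (r i) 1 1.4 ^ 2) y +
      ∑ k ∈ Finset.range i, (S k).indicator (fun _ => cutoffSlope (r k) 1.4 1.9 ^ 2) y
    have hIo := integrable_indicator_annulus (x i) (r i) 1 1.4 (cutoffSlope (r i) 1 1.4 ^ 2)
      MeasurableSet.univ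
    have hIk : ∀ k ∈ Finset.range i, Integrable
        ((S k).indicator fun _ => cutoffSlope (r k) 1.4 1.9 ^ 2) volume := fun k _ =>
      integrable_indicator_annulus (x k) (r k) 1.4 1.9 _ (measurableSet_cell x r i)
    have hIs := integrable_finsetSum _ hIk
    have hG : ∀ y, ‖fderiv ℝ u y‖ ^ 2 ≤ G y := by
      intro y
      -- off its cell the test function vanishes, so the hole annuli count only inside the cell
      by_cases hy : y ∈ cell x r i
      · obtain ⟨L, hL0, hL2, hL⟩ := cutMin_lipschitz (o := o) (h := h) (s := ball y δ)
          (K₀ := (annulus (x i) (r i) 1 1.4).indicator (fun _ => cutoffSlope (r i) 1 1.4) y)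
          (K := fun k => (annulus (x k) (r k) 1.4 1.9).indicator
            (fun _ => cutoffSlope (r k) 1.4 1.9) y) i
          (Set.indicator_nonneg (fun _ _ => (cutoffSlope_pos hri (by norm_num)).le) y)
          (fun z hz w hw => cutoff_lipschitz hri (by norm_num) (hδ i le_rfl) y hz hw)
          (fun k hk z hz w hw => by
            simp only [h]
            rw [sub_sub_sub_cancel_left, abs_sub_comm]
            exact cutoff_lipschitz (hr k hk.le) (by norm_num) (hδ k hk.le) y hz hw)
        have h1 := hlip y L hL0 hL
        refine (pow_le_pow_left₀ (norm_nonneg _) h1 2).trans (hL2.trans (le_of_eq ?_))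
        simp only [G]
        congr 1
        · by_cases hm : y ∈ annulus (x i) (r i) 1 1.4 <;> simp [So, hm]
        · refine Finset.sum_congr rfl fun k _ => ?_
          by_cases hm : y ∈ annulus (x k) (r k) 1.4 1.9 <;> simp [S, hm, hy]
      · have h0 : ‖fderiv ℝ u y‖ ≤ 0 := by
          have hz0 : ∀ z ∈ ball y δ, f z = 0 := by
            intro z hz
            simp only [cell, Set.mem_ofPred_eq, not_and_or, not_lt] at hy
            rcases hy with hy | hy
            · refine hfo z ?_
              have := hnear i hz
              have := hδ i le_rfl
              linarith
            · push Not at hy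
              obtain ⟨k, hk, hky⟩ := hy
              refine hfh k hk z ?_
              have := hnear k hz
              have := hδ k hk.le
              linarith
          refine hlip y 0 le_rfl fun z hz w hw => ?_
          rw [hz0 z hz, hz0 w hw]
          simp
        have h1 : ‖fderiv ℝ u y‖ ^ 2 = 0 := by
          rw [le_antisymm h0 (norm_nonneg _)]; simp
        rw [h1]
        refine add_nonneg (Set.indicator_nonneg (fun _ _ => sq_nonneg _) y)
          (Finset.sum_nonneg fun k _ => Set.indicator_nonneg (fun _ _ => sq_nonneg _) y)
    have hmeas : ∀ k, MeasurableSet (S k) := fun k =>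
      (measurableSet_annulus _ _ _ _).inter (measurableSet_cell x r i)
    calc ∫ y, ‖fderiv ℝ u y‖ ^ 2 ≤ ∫ y, G y :=
          integral_mono_of_nonneg (Filter.Eventually.of_forall fun y => sq_nonneg _)
            (hIo.add hIs) (Filter.Eventually.of_forall hG)
      _ = cutoffSlope (r i) 1 1.4 ^ 2 * volume.real (annulus (x i) (r i) 1 1.4) +
          holeEnergy x r i := by
        simp only [G]
        rw [integral_add hIo hIs, integral_finsetSum _ hIk, holeEnergy]
        congr 1
        · rw [integral_indicator_const _ ((measurableSet_annulus _ _ _ _).inter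
            MeasurableSet.univ), Set.inter_univ, smul_eq_mul, mul_comm]
        · refine Finset.sum_congr rfl fun k _ => ?_
          rw [integral_indicator_const _ (hmeas k), smul_eq_mul, mul_comm]
      _ ≤ 26.6 + holeEnergy x r i := by
        rw [cutoffSlope_sq_mul_volume_annulus hri (by norm_num) (by norm_num)]
        norm_num

end Cutoffs

/-! ### The bound for the potential -/

section Final

open Metric

theorem exists_ae_norm_le {V : Plane → ℝ} (hV : MemLp V ∞ volume) :
    ∃ C : ℝ, ∀ᵐ y, ‖V y‖ ≤ C := by
  have hlt : eLpNormEssSup V volume ≠ ∞ := by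
    rw [← eLpNorm_exponent_top]
    exact hV.2.ne
  refine ⟨(eLpNormEssSup V volume).toReal, ?_⟩
  filter_upwards [ae_le_eLpNormEssSup (f := V) (μ := volume)] with y hy
  rw [← toReal_enorm]
  exact ENNReal.toReal_mono hlt hy

theorem integrable_mul_sq {V : Plane → ℝ} (hV : MemLp V ∞ volume) {u : Plane → ℝ}
    (hu : Continuous u) (hc : HasCompactSupport u) :
    Integrable (fun y => V y * u y ^ 2) volume := by
  obtain ⟨C, hC⟩ := exists_ae_norm_le hV
  have hcs : HasCompactSupport fun y => u y ^ 2 := by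
    simp_rw [sq]
    exact hc.mul_right
  have h1 : Integrable (fun y => u y ^ 2) volume :=
    (hu.pow 2).integrable_of_hasCompactSupport hcs
  exact Integrable.bdd_mul (f := V) h1 hV.1 hC

/-- The measure with density `V`. -/
noncomputable def potentialMeasure (V : Plane → ℝ) : Measure Plane :=
  volume.withDensity fun y => ENNReal.ofReal (V y)

/-- A test function with value `1` on `S` has potential energy at least the mass of `S`. -/
theorem le_integral_mul_sq {V : Plane → ℝ} (hV : MemLp V ∞ volume)
    (hpos : ∀ᵐ y, 0 < V y) {u : Plane → ℝ} (hu : Continuous u) (hc : HasCompactSupport u)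
    {S : Set Plane} (hS : MeasurableSet S) (h1 : ∀ y ∈ S, u y = 1) {T : ℝ}
    (hT : ENNReal.ofReal T ≤ potentialMeasure V S) : T ≤ ∫ y, V y * u y ^ 2 := by
  have hnn : 0 ≤ᵐ[volume] fun y => V y * u y ^ 2 := by
    filter_upwards [hpos] with y hy
    positivity
  rw [← ENNReal.ofReal_le_ofReal_iff (integral_nonneg_of_ae hnn),
    ofReal_integral_eq_lintegral_ofReal (integrable_mul_sq hV hu hc) hnn]
  refine hT.trans ?_
  rw [potentialMeasure, withDensity_apply _ hS]
  calc ∫⁻ y in S, ENNReal.ofReal (V y) = ∫⁻ y in S, ENNReal.ofReal (V y * u y ^ 2) := by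
        refine setLIntegral_congr_fun hS fun y hy => ?_
        simp only [h1 y hy]
        simp
    _ ≤ ∫⁻ y, ENNReal.ofReal (V y * u y ^ 2) := setLIntegral_le_lintegral _ _

theorem exists_potentialMeasure_le {V : Plane → ℝ} (hV : MemLp V ∞ volume) :
    ∃ C : ℝ, 0 < C ∧ potentialMeasure V ≤ ENNReal.ofReal C • volume := by
  obtain ⟨C, hC⟩ := exists_ae_norm_le hV
  refine ⟨max C 1, by positivity, ?_⟩
  rw [potentialMeasure, ← withDensity_const]
  refine withDensity_mono ?_
  filter_upwards [hC] with y hy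
  exact ENNReal.ofReal_le_ofReal (((le_abs_self _).trans hy).trans (le_max_left _ _))

/-- A test function with value `1` on a given square and Dirichlet energy at most `20 / n`: the
average of `n` cutoffs on successive dyadic annuli. -/
theorem exists_testFunction_small_energy {R : ℝ} (hR : 0 < R) {n : ℕ} (hn : 0 < n) :
    ∃ u : Plane → ℝ, ContDiff ℝ (⊤ : ℕ∞) u ∧ HasCompactSupport u ∧
      (∀ y ∈ square 0 R, u y = 1) ∧ ∫ y, ‖fderiv ℝ u y‖ ^ 2 ≤ 20 / n := by
  have hn' : (0 : ℝ) < n := by exact_mod_cast hn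
  let ρ : ℕ → ℝ := fun j => R * 2 ^ j
  have hρ : ∀ j, 0 < ρ j := fun j => by positivity
  have hRρ : ∀ j, R ≤ ρ j := fun j => le_mul_of_one_le_right hR.le (one_le_pow₀ (by norm_num))
  let c : ℕ → Plane → ℝ := fun j => cutoff 0 (ρ j) 1 2
  let f : Plane → ℝ := fun y => (∑ j ∈ Finset.range n, c j y) / n
  have hfc : Continuous f :=
    (continuous_finsetSum _ fun j _ => continuous_cutoff _ _ _ _).div_const _
  have hcs : HasCompactSupport f := by
    refine hasCompactSupport_of_square (x := 0) (r := ρ n) fun y hy => ?_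
    have : ∀ j ∈ Finset.range n, c j y = 0 := by
      intro j hj
      refine cutoff_eq_zero (hρ j) (by norm_num) ?_
      have h1 : ρ (j + 1) ≤ ρ n := by
        refine mul_le_mul_of_nonneg_left (pow_le_pow_right₀ (by norm_num) ?_) hR.le
        exact Finset.mem_range.1 hj
      have h2 : ρ (j + 1) = 2 * ρ j := by simp only [ρ]; ring
      have := hρ j
      linarith
    simp [f, Finset.sum_eq_zero this]
  have hδ0 : 0 < 0.005 * R := by positivity
  obtain ⟨u, hu, huc, hconst, hlip⟩ := exists_mollification hfc hcs hδ0
  refine ⟨u, hu, huc, fun y hy => hconst y 1 fun z hz => ?_, ?_⟩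
  · have : ∀ j ∈ Finset.range n, c j z = 1 := by
      intro j _
      refine cutoff_eq_one (hρ j) (by norm_num) ?_
      have h1 := abs_lt.1 (abs_maxDist_sub_lt (x := 0) hz)
      have h2 := hRρ j
      rw [mem_square] at hy
      linarith
    simp only [f]
    rw [Finset.sum_congr rfl this]
    simp [hn'.ne']
  · let A : ℕ → Set Plane := fun j => annulus 0 (ρ j) 1 2 ∩ Set.univ
    let G : Plane → ℝ := fun y => ∑ j ∈ Finset.range n,
      (A j).indicator (fun _ => cutoffSlope (ρ j) 1 2 ^ 2 / n ^ 2) y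
    have hI : ∀ j ∈ Finset.range n, Integrable
        ((A j).indicator fun _ => cutoffSlope (ρ j) 1 2 ^ 2 / n ^ 2) volume := fun j _ =>
      integrable_indicator_annulus 0 (ρ j) 1 2 _ MeasurableSet.univ
    -- the annuli are disjoint, so that at each point at most one of the slopes contributes
    have hdisj : ∀ i j y, i < j → y ∈ annulus 0 (ρ i) 1 2 → y ∉ annulus 0 (ρ j) 1 2 := by
      rintro i j y hij ⟨h1, -⟩ ⟨-, h2⟩
      apply h2
      rw [mem_square] at h1 ⊢
      have h3 : ρ (i + 1) ≤ ρ j :=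
        mul_le_mul_of_nonneg_left (pow_le_pow_right₀ (by norm_num) hij) hR.le
      have h4 : ρ (i + 1) = 2 * ρ i := by simp only [ρ]; ring
      linarith
    have hG : ∀ y, ‖fderiv ℝ u y‖ ^ 2 ≤ G y := by
      intro y
      let K : ℕ → ℝ := fun j => (annulus 0 (ρ j) 1 2).indicator (fun _ => cutoffSlope (ρ j) 1 2) y
      have hK : ∀ j, 0 ≤ K j := fun j =>
        Set.indicator_nonneg (fun _ _ => (cutoffSlope_pos (hρ j) (by norm_num)).le) y
      have h1 : ‖fderiv ℝ u y‖ ≤ (∑ j ∈ Finset.range n, K j) / n := by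
        refine hlip y _ (div_nonneg (Finset.sum_nonneg fun j _ => hK j) hn'.le)
          fun z hz w hw => ?_
        simp only [f]
        rw [← sub_div, abs_div, abs_of_pos hn', div_mul_eq_mul_div, ← Finset.sum_sub_distrib,
          Finset.sum_mul]
        gcongr
        refine (Finset.abs_sum_le_sum_abs _ _).trans (Finset.sum_le_sum fun j _ => ?_)
        exact cutoff_lipschitz (hρ j) (by norm_num)
          (mul_le_mul_of_nonneg_left (hRρ j) (by norm_num)) y hz hw
      have hGK : G y = (∑ j ∈ Finset.range n, K j ^ 2) / n ^ 2 := by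
        simp only [G, Finset.sum_div]
        refine Finset.sum_congr rfl fun j _ => ?_
        by_cases hm : y ∈ annulus 0 (ρ j) 1 2 <;> simp [A, K, hm]
      rw [hGK]
      refine (pow_le_pow_left₀ (norm_nonneg _) h1 2).trans (le_of_eq ?_)
      rw [div_pow]
      congr 1
      by_cases hex : ∃ j ∈ Finset.range n, y ∈ annulus 0 (ρ j) 1 2
      · obtain ⟨j, hj, hjy⟩ := hex
        have h0 : ∀ i ∈ Finset.range n, i ≠ j → K i = 0 := by
          intro i _ hij
          refine Set.indicator_of_notMem (fun hiy => ?_) _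
          rcases lt_or_gt_of_ne hij with h | h
          · exact hdisj i j y h hiy hjy
          · exact hdisj j i y h hjy hiy
        rw [Finset.sum_eq_single_of_mem j hj h0,
          Finset.sum_eq_single_of_mem j hj fun i hi hij => by simp [h0 i hi hij]]
      · push Not at hex
        have h0 : ∀ i ∈ Finset.range n, K i = 0 := fun i hi =>
          Set.indicator_of_notMem (hex i hi) _
        rw [Finset.sum_eq_zero h0, Finset.sum_eq_zero fun i hi => by simp [h0 i hi]]
        simp
    calc ∫ y, ‖fderiv ℝ u y‖ ^ 2 ≤ ∫ y, G y :=
          integral_mono_of_nonneg (Filter.Eventually.of_forall fun y => sq_nonneg _)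
            (integrable_finsetSum _ hI) (Filter.Eventually.of_forall hG)
      _ = ∑ j ∈ Finset.range n,
          cutoffSlope (ρ j) 1 2 ^ 2 * volume.real (annulus 0 (ρ j) 1 2) / n ^ 2 := by
        simp only [G]
        rw [integral_finsetSum _ hI]
        refine Finset.sum_congr rfl fun j _ => ?_
        rw [integral_indicator_const _ ((measurableSet_annulus _ _ _ _).inter
          MeasurableSet.univ), Set.inter_univ, smul_eq_mul]
        ring
      _ ≤ ∑ j ∈ Finset.range n, 20 / (n : ℝ) ^ 2 := by
        refine Finset.sum_le_sum fun j _ => ?_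
        rw [cutoffSlope_sq_mul_volume_annulus (hρ j) (by norm_num) (by norm_num)]
        gcongr
        norm_num
      _ = 20 / n := by
        rw [Finset.sum_const, Finset.card_range, nsmul_eq_mul]
        field_simp

/-- In the plane every positive potential binds, however weak it is: the test functions with value `1`
on a fixed square have arbitrarily small Dirichlet energy. -/
theorem not_negativeSpectrumConsistsOf_zero {V : Plane → ℝ} (hV : MemLp V ∞ volume)
    (hpos : ∀ᵐ y, 0 < V y) : ¬ NegativeSpectrumConsistsOf (schrodingerOp V hV) 0 := by
  intro hN
  obtain ⟨m, hm0, hm⟩ : ∃ m : ℝ, 0 < m ∧ ENNReal.ofReal m ≤ potentialMeasure V (square 0 1) := by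
    have hne : potentialMeasure V (square 0 1) ≠ 0 := by
      rw [potentialMeasure, withDensity_apply _ (measurableSet_square 0 1)]
      intro h0
      rw [lintegral_eq_zero_iff' hV.1.aemeasurable.ennreal_ofReal.restrict] at h0
      have h1 : ∀ᵐ y ∂(volume.restrict (square (0 : Plane) 1)), False := by
        filter_upwards [h0, ae_restrict_of_ae hpos] with y h2 h3
        simp only [Pi.zero_apply, ENNReal.ofReal_eq_zero] at h2
        linarith
      rw [Filter.eventually_false_iff_eq_bot, ae_eq_bot, Measure.restrict_eq_zero,
        volume_square 0 zero_le_one] at h1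
      norm_num at h1
    obtain ⟨q, hq0, hq⟩ := ENNReal.lt_iff_exists_nnreal_btwn.1 (pos_iff_ne_zero.2 hne)
    refine ⟨q, by exact_mod_cast hq0, ?_⟩
    rw [ENNReal.ofReal_coe_nnreal]
    exact hq.le
  obtain ⟨n, hn⟩ := exists_nat_gt (20 / m)
  have hn0 : 0 < n := by
    have : (0 : ℝ) < n := lt_trans (by positivity) hn
    exact_mod_cast this
  obtain ⟨u, hu, hc, h1, hE⟩ := exists_testFunction_small_energy one_pos hn0
  refine false_of_disjoint_negative_energy V hV hN (fun _ => u) (fun _ => hu) (fun _ => hc)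
    (fun i j hij => absurd (Subsingleton.elim (α := Fin 1) i j) hij) fun _ => ?_
  have hmass := le_integral_mul_sq hV hpos hu.continuous hc (measurableSet_square 0 1) h1 hm
  refine hE.trans_lt (lt_of_lt_of_le ?_ hmass)
  have : (0 : ℝ) < n := by exact_mod_cast hn0
  rw [div_lt_iff₀ this]
  rwa [div_lt_iff₀ hm0, mul_comm] at hn

/-- If the mass of `V` were larger, `2 * N + 1` squares of mass at least `84` could be selected. At
least `N + 1` of their test functions have hole energy below `57.4`, twice its mean, hence Dirichlet
energy below `26.6 + 57.4 = 84`. -/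
theorem potentialMeasure_univ_le {V : Plane → ℝ} (hV : MemLp V ∞ volume)
    (hpos : ∀ᵐ y, 0 < V y) {N : ℕ}
    (hN : NegativeSpectrumConsistsOf (schrodingerOp V hV) N) :
    potentialMeasure V Set.univ ≤ ENNReal.ofReal ((2 * N + 1 : ℕ) * (4 * 84)) := by
  by_contra! hlt
  obtain ⟨C, hC, hμ⟩ := exists_potentialMeasure_le hV
  obtain ⟨x, r, -, hsq⟩ := exists_squares hC hμ (by norm_num : (0 : ℝ) < 84) (2 * N + 1) hlt
  have hr : ∀ k < 2 * N + 1, 0 < r k := fun k hk => (hsq k hk).1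
  have htest : ∀ i : Fin (2 * N + 1), _ := fun i =>
    exists_testFunction x r i fun k hk => hr k (lt_of_le_of_lt hk i.2)
  choose u hu hc hsupp hone hE using htest
  let bad : Finset (Fin (2 * N + 1)) := Finset.univ.filter fun i => 57.4 ≤ holeEnergy x r i
  have hnn : ∀ i, 0 ≤ holeEnergy x r i := fun i =>
    Finset.sum_nonneg fun k _ => by positivity
  have hbad : bad.card ≤ N := by
    have h1 : (bad.card : ℝ) * 57.4 ≤ (2 * N : ℕ) * 28.7 := by
      calc (bad.card : ℝ) * 57.4 = ∑ _i ∈ bad, (57.4 : ℝ) := by simp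
        _ ≤ ∑ i ∈ bad, holeEnergy x r i :=
          Finset.sum_le_sum fun i hi => (Finset.mem_filter.1 hi).2
        _ ≤ ∑ i : Fin (2 * N + 1), holeEnergy x r i :=
          Finset.sum_le_sum_of_subset_of_nonneg (Finset.subset_univ _) fun i _ _ => hnn i
        _ = ∑ i ∈ Finset.range (2 * N + 1), holeEnergy x r i :=
          Fin.sum_univ_eq_sum_range (holeEnergy x r) _
        _ ≤ (2 * N : ℕ) * 28.7 :=
          sum_holeEnergy_le x r (2 * N) fun k hk => hr k (hk.trans (Nat.lt_succ_self _))
    have h2 : (bad.card : ℝ) ≤ N := by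
      push_cast at h1
      linarith
    exact_mod_cast h2
  have hgood : N + 1 ≤ badᶜ.card := by
    rw [Finset.card_compl, Fintype.card_fin]
    omega
  obtain ⟨e, he⟩ : ∃ e : Fin (N + 1) ↪ Fin (2 * N + 1), ∀ j, e j ∈ badᶜ := by
    obtain ⟨t, hts, htc⟩ := Finset.exists_subset_card_eq hgood
    exact ⟨(t.orderEmbOfFin htc).toEmbedding, fun j => hts (t.orderEmbOfFin_mem htc j)⟩
  have hdisj : ∀ i j : Fin (2 * N + 1), i < j → Disjoint (tsupport (u i)) (tsupport (u j)) := by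
    intro i j hij
    rw [Set.disjoint_left]
    intro y hi hj
    have h1 := (hsupp i y hi).1
    have h2 := (hsupp j y hj).2 i hij
    have := hr i i.2
    linarith
  refine false_of_disjoint_negative_energy V hV hN (fun j => u (e j)) (fun j => hu _)
    (fun j => hc _) (fun i j hij => ?_) fun j => ?_
  · rcases lt_or_gt_of_ne (e.injective.ne hij) with h | h
    · exact hdisj _ _ h
    · exact (hdisj _ _ h).symm
  · have hsm : MeasurableSet (square (x (e j)) (r (e j)) \ swept x r (e j)) :=
      (measurableSet_square _ _).diff (measurableSet_swept x r _)
    have hmass := le_integral_mul_sq hV hpos (hu (e j)).continuous (hc (e j)) hsm (hone (e j))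
      (hsq (e j) (e j).2).2
    have hlow : holeEnergy x r (e j) < 57.4 := by
      simpa [bad] using he j
    have := hE (e j)
    linarith

end Final

end Schrodinger

theorem mainTheorem4
    (V : Schrodinger.Plane → ℝ)
    (hV : MemLp V ∞ volume)
    (hpos : ∀ᵐ x : Schrodinger.Plane, 0 < V x)
    (N : ℕ)
    (hN : Schrodinger.NegativeSpectrumConsistsOf (Schrodinger.schrodingerOp V hV) N) :
    Integrable V volume ∧ ∫ x, V x ≤ ((6 : ℝ) ^ 4 + 12 + 4 * N) * N := by
  have hN1 : (1 : ℝ) ≤ N := by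
    rcases Nat.eq_zero_or_pos N with rfl | h
    · exact (Schrodinger.not_negativeSpectrumConsistsOf_zero hV hpos hN).elim
    · exact_mod_cast h
  have hle := Schrodinger.potentialMeasure_univ_le hV hpos hN
  rw [Schrodinger.potentialMeasure, withDensity_apply _ MeasurableSet.univ,
    setLIntegral_univ] at hle
  have hnn : 0 ≤ᵐ[volume] V := by
    filter_upwards [hpos] with y hy using hy.le
  have hint : Integrable V volume :=
    (lintegral_ofReal_ne_top_iff_integrable hV.1 hnn).1
      (ne_top_of_le_ne_top ENNReal.ofReal_ne_top hle)
  refine ⟨hint, ?_⟩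
  rw [← ofReal_integral_eq_lintegral_ofReal hint hnn,
    ENNReal.ofReal_le_ofReal_iff (by positivity)] at hle
  refine hle.trans ?_
  -- `(2 * N + 1) * 336 ≤ 1008 * N`, as `1 ≤ N`
  push_cast
  nlinarith
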